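/- Let $\beta>0$, $\alpha\in(-1,1)$, $c_+,c_->0$ and $\alpha+\beta^{-1}>1$. Let $B_\beta=(B_\beta(t))_{t\ge 0}$ be a real càdlàg process that is self-similar with index $\beta$: for every $a>0$ the processes $(B_\beta(at))_{t\ge0}$ and $(a^\beta B_\beta(t))_{t\ge0}$ have the same distribution. For $\varepsilon>0$ consider $$X_\varepsilon(t)=\int_0^t\bigl(c_+\mathbf 1_{X_\varepsilon(s)\ge 0}-c_-\mathbf 1_{X_\varepsilon(s)<0}\bigr)|X_\varepsilon(s)|^\alpha\,ds+\varepsilon B_\beta(t),\qquad t\ge 0. \tag{$E_\varepsilon$}$$ A weak solution of $(E_\varepsilon)$ is a pair of adapted càdlàg processes $(X,B)$ on a filtered probability space such that $B$ has the distribution of $B_\beta$ and, a.s., for all $t\ge0$, $|X|^\alpha$ is integrable on $[0,t]$ (with $0^\alpha=\infty$ if $\alpha<0$) and $(E_\varepsilon)$ holds with $B$ in place of $B_\beta$. If $B_\beta$ is a Lévy process or a (multiple of a) fractional Brownian motion with Hurst parameter in $(0,1)$, then $B$ is in addition required to be such a process with respect to the filtration $(\mathcal F_t)$: in the Lévy case,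 $B(t)-B(s)$ is independent of $\mathcal F_s$ for all $s\le t$; in the fractional case, the Wiener process in the Volterra representation of $B$ is a Wiener process with respect to $(\mathcal F_t)$ or, equivalently, $B$ is conditionally independent of $\mathcal F_s$ given $\sigma(B(r),r\le s)$ for every $s$. Suppose: 1. $(E_1)$ has a weak solution $(X,B)$ on some $(\Omega,\mathcal F,(\mathcal F_t),\mathbf P)$, and all weak solutions of $(E_1)$ have the same distribution; 2. $\mathbf P(\lim_{t\to\infty}|X(t)|=\infty)=1$; 3. either $\alpha\in(0,1)$ and there are a (deterministic) function $h$ with $h(t)=o(t^{1/(1-\alpha)})$, $t\to\infty$, and random times $t_n\ge 0$ with $\lim_{n\to\infty} t_n=\infty$ such that a.s. $|B(t)-B(t_n)|\le h(t-t_n)$ for all $n$ and all $t\ge t_n$; or $\alpha\in(-1,0]$ and $B(t)=o(t^{1/(1-\alpha)})$, $t\to\infty$, a.s. For every $\varepsilon>0$ let $X_\varepsilon$ be (the first component of) a weak solution of $(E_\varepsilon)$. Then, as $\varepsilon\to0+$, the distributions of $X_\varepsilon$ converge weakly in $D([0,\infty))$ with the Skorokhod $J_1$ topology to the distribution of $$Y(t)=((1-\alpha)t)^{\frac1{1-\alpha}}\Bigl(c_+^{\frac1{1-\alpha}}\mathbf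 1_{\{\lim_{s\to\infty}X(s)=+\infty\}}-c_-^{\frac1{1-\alpha}}\mathbf 1_{\{\lim_{s\to\infty}X(s)=-\infty\}}\Bigr),\qquad t\ge0.$$ Moreover, $X^+(t)=(c_+(1-\alpha)t)^{\frac1{1-\alpha}}$ and $X^-(t)=-(c_-(1-\alpha)t)^{\frac1{1-\alpha}}$ are the maximal and the minimal solution of $x(t)=\int_0^t(c_+\mathbf 1_{x(s)\ge 0}-c_-\mathbf 1_{x(s)<0})|x(s)|^\alpha ds$, $t\ge 0$, and $\mathbf P(Y=X^\pm)=p_\pm:=\mathbf P(\lim_{t\to\infty}X(t)=\pm\infty)$. If $\alpha\in(0,1)$, then $p_++p_-=1$. -/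

import Mathlib

open Filter Topology MeasureTheory ProbabilityTheory
open scoped NNReal ENNReal

namespace SmallNoise

noncomputable section

/-! ### The space `D([0,∞))` with the Skorokhod (J1) topology -/

/-- A real function on `[0,∞)` is càdlàg: right-continuous with (finite) left limits. -/
def IsCadlag (f : ℝ≥0 → ℝ) : Prop :=
  ∀ t, ContinuousWithinAt f (Set.Ici t) t ∧ ∃ l, Tendsto f (𝓝[<] t) (𝓝 l)

/-- The path space `D([0,∞))`. -/
structure CadlagPath where
  toFun : ℝ≥0 → ℝ
  isCadlag : IsCadlag toFun

instance : CoeFun CadlagPath (fun _ => ℝ≥0 → ℝ) := ⟨CadlagPath.toFun⟩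

/-- `(x, y)` lies in the entourage of size `r = (T, δ)` if there is a time change `l`, i.e. an
increasing bijection of `[0,∞)`, with `|l t - t| ≤ δ` and `|x t - y (l t)| ≤ δ` for all `t ≤ T`. -/
def skorokhodEntourage (T δ : ℝ≥0) : Set (CadlagPath × CadlagPath) :=
  {p | ∃ l : ℝ≥0 ≃o ℝ≥0, ∀ t ≤ T, dist (l t) t ≤ δ ∧ dist (p.1 t) (p.2 (l t)) ≤ δ}

theorem skorokhodEntourage_mono {T T' δ δ' : ℝ≥0} (hT : T' ≤ T) (hδ : δ ≤ δ') :
    skorokhodEntourage T δ ⊆ skorokhodEntourage T' δ' := by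
  rintro p ⟨l, hl⟩
  refine ⟨l, fun t ht => ⟨(hl t (ht.trans hT)).1.trans ?_, (hl t (ht.trans hT)).2.trans ?_⟩⟩ <;>
    exact_mod_cast hδ

theorem skorokhodEntourage_refl (T δ : ℝ≥0) (x : CadlagPath) :
    (x, x) ∈ skorokhodEntourage T δ :=
  ⟨OrderIso.refl _, fun t _ => by simp⟩

theorem skorokhodEntourage_symm (T δ : ℝ≥0) :
    skorokhodEntourage (T + δ) δ ⊆ Prod.swap ⁻¹' skorokhodEntourage T δ := by
  rintro ⟨x, y⟩ ⟨l, hl⟩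
  refine ⟨l.symm, fun s hs => ?_⟩
  have hle : l.symm s ≤ T + δ := by
    rw [OrderIso.symm_apply_le]
    refine hs.trans ?_
    have h := (hl (T + δ) le_rfl).1
    rw [NNReal.dist_eq, abs_le] at h
    have h1 := h.1
    push_cast at h1
    exact_mod_cast (by linarith : (T : ℝ) ≤ (l (T + δ) : ℝ))
  have h := hl _ hle
  simp only [OrderIso.apply_symm_apply] at h
  exact ⟨by rw [dist_comm]; exact h.1, by rw [dist_comm]; exact h.2⟩

theorem skorokhodEntourage_comp {x y z : CadlagPath} {T δ : ℝ≥0}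
    (hxy : (x, y) ∈ skorokhodEntourage (T + δ) δ) (hyz : (y, z) ∈ skorokhodEntourage (T + δ) δ) :
    (x, z) ∈ skorokhodEntourage T (δ + δ) := by
  obtain ⟨l, hl⟩ := hxy
  obtain ⟨m, hm⟩ := hyz
  refine ⟨l.trans m, fun t ht => ?_⟩
  have h1 := hl t (ht.trans (by simp))
  have hlt : l t ≤ T + δ := by
    have h := h1.1
    rw [NNReal.dist_eq, abs_le] at h
    have h2 : (t : ℝ) ≤ T := by exact_mod_cast ht
    exact_mod_cast (by push_cast; linarith [h.2] : (l t : ℝ) ≤ ((T + δ : ℝ≥0) : ℝ))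
  have h2 := hm (l t) hlt
  simp only [OrderIso.trans_apply]
  push_cast
  exact ⟨(dist_triangle _ (l t) _).trans (by linarith [h1.1, h2.1]),
    (dist_triangle _ (y (l t)) _).trans (by linarith [h1.2, h2.2])⟩

/-- The entourages `skorokhodEntourage T δ`, `T ≥ 0`, `δ > 0`, form a filter basis. -/
def skorokhodBasis : FilterBasis (CadlagPath × CadlagPath) where
  sets := {s | ∃ T δ : ℝ≥0, 0 < δ ∧ s = skorokhodEntourage T δ}
  nonempty := ⟨_, 0, 1, one_pos, rfl⟩
  inter_sets := by
    rintro _ _ ⟨T, δ, hδ, rfl⟩ ⟨T', δ', hδ', rfl⟩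
    exact ⟨_, ⟨max T T', min δ δ', lt_min hδ hδ', rfl⟩, Set.subset_inter
      (skorokhodEntourage_mono (le_max_left _ _) (min_le_left _ _))
      (skorokhodEntourage_mono (le_max_right _ _) (min_le_right _ _))⟩

/-- The Skorokhod uniformity on `D([0,∞))`. Its topology is the Skorokhod J1 topology: `x n → x`
iff for all `T` there are time changes `l n` with `l n t - t → 0` and `x t - x n (l n t) → 0`
uniformly in `t ≤ T`. -/
instance : UniformSpace CadlagPath :=
  UniformSpace.ofCore <| UniformSpace.Core.mkOfBasis skorokhodBasis
    (by rintro _ ⟨T, δ, -, rfl⟩ x; exact skorokhodEntourage_refl T δ x)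
    (by
      rintro _ ⟨T, δ, hδ, rfl⟩
      exact ⟨_, ⟨T + δ, δ, hδ, rfl⟩, skorokhodEntourage_symm T δ⟩)
    (by
      rintro _ ⟨T, δ, hδ, rfl⟩
      refine ⟨_, ⟨T + δ / 2, δ / 2, half_pos hδ, rfl⟩, ?_⟩
      rintro ⟨x, z⟩ ⟨y, hxy, hyz⟩
      have h := skorokhodEntourage_comp hxy hyz
      rwa [add_halves] at h)

instance : MeasurableSpace CadlagPath := borel CadlagPath

instance : BorelSpace CadlagPath := ⟨rfl⟩

/-! ### The equation -/

/-- The drift `(c₊ 1_{x ≥ 0} - c₋ 1_{x < 0}) |x| ^ α`. -/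
def drift (cp cm α x : ℝ) : ℝ := (if 0 ≤ x then cp else -cm) * |x| ^ α

/-- `x` solves `x(t) = ∫₀ᵗ (c₊ 1_{x(s) ≥ 0} - c₋ 1_{x(s) < 0}) |x(s)| ^ α ds + g(t)` for `t ≥ 0`.
The first clause says that `|x| ^ α` is locally integrable; the power is taken in `[0,∞]`, so that
`0 ^ α = ∞` for `α < 0`. -/
def SolvesEquation (cp cm α : ℝ) (x g : ℝ≥0 → ℝ) : Prop :=
  ∀ t : ℝ≥0,
    (∫⁻ s in Set.Ioc (0 : ℝ) t, ‖x s.toNNReal‖ₑ ^ α) ≠ ∞ ∧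
    x t = (∫ s in (0 : ℝ)..t, drift cp cm α (x s.toNNReal)) + g t

/-! ### The noise -/

variable {Ω : Type*} [MeasurableSpace Ω]

/-- `B` is a process which is self-similar with index `β`: for each `a > 0` the processes
`(B(a t))_t` and `(a ^ β B(t))_t` have the same distribution. -/
def IsSelfSimilar (β : ℝ) (P : Measure Ω) (B : Ω → CadlagPath) : Prop :=
  ∀ a : ℝ≥0, 0 < a →
    IdentDistrib (fun ω (t : ℝ≥0) => B ω (a * t)) (fun ω (t : ℝ≥0) => (a : ℝ) ^ β * B ω t) P P

/-- `B` is a Lévy process: `B(0) = 0` a.s., with independent and stationary increments. -/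
def IsLevyProcess (P : Measure Ω) (B : Ω → CadlagPath) : Prop :=
  (∀ t, AEMeasurable (fun ω => B ω t) P) ∧ (∀ᵐ ω ∂P, B ω 0 = 0) ∧
    HasIndepIncrements (fun t ω => B ω t) P ∧
    ∀ s t : ℝ≥0, IdentDistrib (fun ω => B ω (s + t) - B ω s) (fun ω => B ω t) P P

/-- `B` is (a nonzero multiple of) a fractional Brownian motion with Hurst parameter `H`: a centred
Gaussian process with covariance `(σ² / 2) (s ^ 2H + t ^ 2H - |t - s| ^ 2H)`. -/
def IsFractionalBrownianMotion (H : ℝ) (P : Measure Ω) (B : Ω → CadlagPath) : Prop :=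
  IsGaussianProcess (fun t ω => B ω t) P ∧ (∀ t, ∫ ω, B ω t ∂P = 0) ∧
    ∃ σ : ℝ, σ ≠ 0 ∧ ∀ s t : ℝ≥0, covariance (fun ω => B ω s) (fun ω => B ω t) P =
      σ ^ 2 / 2 * ((s : ℝ) ^ (2 * H) + (t : ℝ) ^ (2 * H) - |(t : ℝ) - s| ^ (2 * H))

/-- The increments of `B` after time `s` are independent of `F s`. -/
def HasIncrementsIndepOf (P : Measure Ω) (F : Filtration ℝ≥0 ‹MeasurableSpace Ω›)
    (B : Ω → CadlagPath) : Prop :=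
  ∀ s t : ℝ≥0, s ≤ t →
    Indep (F s) (MeasurableSpace.comap (fun ω => B ω t - B ω s) inferInstance) P

/-- The `σ`-algebra generated by `B` up to time `s`. -/
abbrev pastOf (B : Ω → CadlagPath) (s : ℝ≥0) : MeasurableSpace Ω :=
  ⨆ r : Set.Iic s, MeasurableSpace.comap (fun ω => B ω r) inferInstance

/-- Given the past of `B` up to time `s`, the process `B` is conditionally independent of `F s`.
For a fractional Brownian motion adapted to `F` this says that the Wiener process `W` of its
Volterra representation `B(t) = ∫₀ᵗ K(t, s) dW(s)`, which generates the same completed filtration as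
`B`, is a Wiener process with respect to `F`. -/
def IsCompatibleWith (P : Measure Ω) (F : Filtration ℝ≥0 ‹MeasurableSpace Ω›)
    (B : Ω → CadlagPath) : Prop :=
  ∀ (s : ℝ≥0) (A : Set Ω),
    MeasurableSet[⨆ r : ℝ≥0, MeasurableSpace.comap (fun ω => B ω r) inferInstance] A →
      P⟦A | F s⟧ =ᵐ[P] P⟦A | pastOf B s⟧

/-! ### Weak solutions -/

/-- `(X, B)`, defined on `(Ω, F, P)`, is a weak solution of
`X(t) = ∫₀ᵗ (c₊ 1_{X(s) ≥ 0} - c₋ 1_{X(s) < 0}) |X(s)| ^ α ds + ε B(t)`, `t ≥ 0`,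
where the noise has the distribution of the process `B₀` on `(Ω₀, P₀)`. If `B₀` is a Lévy process
or a fractional Brownian motion, then `B` is required to be so with respect to `F`. -/
structure IsWeakSolution {Ω₀ : Type*} [MeasurableSpace Ω₀] (P₀ : Measure Ω₀)
    (B₀ : Ω₀ → CadlagPath) (cp cm α ε : ℝ) (P : Measure Ω)
    (F : Filtration ℝ≥0 ‹MeasurableSpace Ω›) (X B : Ω → CadlagPath) : Prop where
  adapted_solution : Adapted F (fun t ω => X ω t)
  adapted_noise : Adapted F (fun t ω => B ω t)
  noise_law : IdentDistrib (fun ω (t : ℝ≥0) => B ω t) (fun ω (t : ℝ≥0) => B₀ ω t) P P₀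
  levy : IsLevyProcess P₀ B₀ → HasIncrementsIndepOf P F B
  fractional : (∃ H ∈ Set.Ioo (0 : ℝ) 1, IsFractionalBrownianMotion H P₀ B₀) →
    IsCompatibleWith P F B
  equation : ∀ᵐ ω ∂P, SolvesEquation cp cm α (X ω) (fun t => ε * B ω t)

/-- Uniqueness of the weak solution: all weak solutions have the same distribution. -/
def WeakUniqueness.{u, v} {Ω₀ : Type v} [MeasurableSpace Ω₀] (P₀ : Measure Ω₀)
    (B₀ : Ω₀ → CadlagPath) (cp cm α ε : ℝ) : Prop :=
  ∀ (Ω₁ Ω₂ : Type u) [MeasurableSpace Ω₁] [MeasurableSpace Ω₂]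
    (P₁ : Measure Ω₁) (P₂ : Measure Ω₂) [IsProbabilityMeasure P₁] [IsProbabilityMeasure P₂]
    (F₁ : Filtration ℝ≥0 ‹MeasurableSpace Ω₁›) (F₂ : Filtration ℝ≥0 ‹MeasurableSpace Ω₂›)
    (X₁ B₁ : Ω₁ → CadlagPath) (X₂ B₂ : Ω₂ → CadlagPath),
    IsWeakSolution P₀ B₀ cp cm α ε P₁ F₁ X₁ B₁ → IsWeakSolution P₀ B₀ cp cm α ε P₂ F₂ X₂ B₂ →
      IdentDistrib (fun ω (t : ℝ≥0) => X₁ ω t) (fun ω (t : ℝ≥0) => X₂ ω t) P₁ P₂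

/-! ### Growth of the noise and the limit process -/

/-- The growth condition for `0 < α < 1`: for some deterministic `h(t) = o(t ^ (1 / (1 - α)))`,
a.s. there are (random) times `τ n → ∞` with `|B(t) - B(τ n)| ≤ h(t - τ n)` for `t ≥ τ n`. -/
def IncrementGrowth (α : ℝ) (P : Measure Ω) (B : Ω → CadlagPath) : Prop :=
  ∃ h : ℝ≥0 → ℝ, h =o[atTop] (fun t : ℝ≥0 => (t : ℝ) ^ (1 / (1 - α))) ∧
    ∀ᵐ ω ∂P, ∃ τ : ℕ → ℝ≥0, Tendsto τ atTop atTop ∧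
      ∀ n t, τ n ≤ t → |B ω t - B ω (τ n)| ≤ h (t - τ n)

/-- The growth condition for `-1 < α ≤ 0`: `B(t) = o(t ^ (1 / (1 - α)))` a.s. -/
def SublinearGrowth (α : ℝ) (P : Measure Ω) (B : Ω → CadlagPath) : Prop :=
  ∀ᵐ ω ∂P, (fun t : ℝ≥0 => B ω t) =o[atTop] (fun t : ℝ≥0 => (t : ℝ) ^ (1 / (1 - α)))

/-- The path `t ↦ ((1 - α) t) ^ (1 / (1 - α)) k`. -/
def powerPath (α : ℝ) (hα : α < 1) (k : ℝ) : CadlagPath where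
  toFun t := ((1 - α) * t) ^ (1 / (1 - α)) * k
  isCadlag := by
    have hc : Continuous fun t : ℝ≥0 => ((1 - α) * (t : ℝ)) ^ (1 / (1 - α)) * k := by
      refine Continuous.mul (Continuous.rpow_const (by fun_prop) fun _ => Or.inr ?_)
        continuous_const
      exact (one_div_pos.2 (by linarith)).le
    exact fun t => ⟨hc.continuousWithinAt, _, (hc.tendsto t).mono_left nhdsWithin_le_nhds⟩

/-- The event `X(t) → +∞` as `t → ∞`. -/
def toPosInfty (X : Ω → CadlagPath) : Set Ω := {ω | Tendsto (X ω) atTop atTop}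

/-- The event `X(t) → -∞` as `t → ∞`. -/
def toNegInfty (X : Ω → CadlagPath) : Set Ω := {ω | Tendsto (X ω) atTop atBot}

/-- The process
`((1 - α) t) ^ (1 / (1 - α)) (c₊ ^ (1 / (1 - α)) 1_{X → +∞} - c₋ ^ (1 / (1 - α)) 1_{X → -∞})`. -/
def limitProcess (cp cm α : ℝ) (hα : α < 1) (X : Ω → CadlagPath) (ω : Ω) : CadlagPath :=
  powerPath α hα
    (cp ^ (1 / (1 - α)) * (toPosInfty X).indicator 1 ω
      - cm ^ (1 / (1 - α)) * (toNegInfty X).indicator 1 ω)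

/-- `X⁺(t) = (c₊ (1 - α) t) ^ (1 / (1 - α))`. -/
def maxPath (cp α : ℝ) (hα : α < 1) : CadlagPath := powerPath α hα (cp ^ (1 / (1 - α)))

/-- `X⁻(t) = -(c₋ (1 - α) t) ^ (1 / (1 - α))`. -/
def minPath (cm α : ℝ) (hα : α < 1) : CadlagPath := powerPath α hα (-cm ^ (1 / (1 - α)))

end

end SmallNoise

universe u v

/-! The drift is homogeneous of degree α and the noise is self-similar. Hence, if X_ε solves the
equation with noise ε B and ε = l ^ (1 - β (1 - α)), then t ↦ l⁻¹ X_ε(l ^ (1 - α) t) solves the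
equation with ε = 1. By uniqueness in law, X_ε is distributed as t ↦ l X(l ^ (-(1 - α)) t)
(`IsWeakSolution.map_eq_scale`). Because α + β⁻¹ > 1, ε → 0 forces l → 0: small noise becomes large
time for the single process X. It remains to show that a.s. X(t) / t ^ γ, with γ = 1 / (1 - α),
converges to the constant of the limit process; the rescaled paths then converge locally uniformly
(`tendsto_scalePath`), and a.s. convergence gives convergence in law.

The asymptotics are pathwise (`HasPowerDrift.asymptotics`). Write x = A + b, where the integrated
drift A is continuous even if b jumps. The curve K t ^ γ solves y' = c y ^ α for K = κ = (c (1 - α))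
^ γ; it is a strict supersolution for K > κ and a strict subsolution for 0 < K < κ, which leaves
room for a noise of size δ t ^ γ. Comparing A with such barriers gives both bounds; the negative
side follows by reflection.

For α ≤ 0 the drift is nonincreasing on the positive side, so A returns to a barrier from far away
and b = o(t ^ γ) suffices; a path tending to neither infinity is o(t ^ γ). For α > 0 deviations are
amplified, so the lower barrier k (t - τ) ^ γ starts afresh at a late time τ after which the
increments of the noise are small uniformly in τ. As |x| → ∞, either x or -x is already above its
barrier at τ + S. This also decides the sign of the limit and gives p₊ + p₋ = 1.

Laws on the path space are determined by fixed times because every càdlàg path is the Skorokhod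
limit of its discretizations (`tendsto_stepPath`). -/

namespace SmallNoise

/-! ### Power functions -/

theorem one_div_one_sub_mul {α : ℝ} (hα : α < 1) : 1 / (1 - α) * α = 1 / (1 - α) - 1 := by
  have : (1 - α) ≠ 0 := by linarith
  field_simp
  ring

/-- After multiplication by t ^ (γ - 1), γ = 1 / (1 - α), this says that K t ^ γ is a strict
supersolution of y' = c y ^ α. It reduces to c (1 - α) < K ^ (1 - α). -/
theorem mul_rpow_lt_of_lt {c α K : ℝ} (hc : 0 < c) (hα : α < 1)
    (hK : (c * (1 - α)) ^ (1 / (1 - α)) < K) : c * K ^ α < K * (1 / (1 - α)) := by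
  have h1 : 0 < 1 - α := by linarith
  have h2 : 0 < c * (1 - α) := by positivity
  have hK0 : 0 < K := lt_trans (by positivity) hK
  have h3 := Real.rpow_lt_rpow (by positivity) hK h1
  rw [← Real.rpow_mul h2.le, one_div_mul_cancel h1.ne', Real.rpow_one] at h3
  have h4 : K ^ α * K ^ (1 - α) = K := by
    rw [← Real.rpow_add hK0]; simp
  have h5 : 0 < K ^ α := by positivity
  rw [mul_one_div, lt_div_iff₀ h1]
  calc c * K ^ α * (1 - α) = K ^ α * (c * (1 - α)) := by ring
    _ < K ^ α * K ^ (1 - α) := by gcongr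
    _ = K := h4

/-- The counterpart for strict subsolutions k t ^ γ. -/
theorem lt_mul_rpow_of_lt {c α k : ℝ} (hc : 0 < c) (hα : α < 1) (hk0 : 0 < k)
    (hk : k < (c * (1 - α)) ^ (1 / (1 - α))) : k * (1 / (1 - α)) < c * k ^ α := by
  have h1 : 0 < 1 - α := by linarith
  have h2 : 0 < c * (1 - α) := by positivity
  have h3 := Real.rpow_lt_rpow hk0.le hk h1
  rw [← Real.rpow_mul h2.le, one_div_mul_cancel h1.ne', Real.rpow_one] at h3
  have h4 : k ^ α * k ^ (1 - α) = k := by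
    rw [← Real.rpow_add hk0]; simp
  have h5 : 0 < k ^ α := by positivity
  rw [mul_one_div, div_lt_iff₀ h1]
  calc k = k ^ α * k ^ (1 - α) := h4.symm
    _ < k ^ α * (c * (1 - α)) := by gcongr
    _ = c * k ^ α * (1 - α) := by ring

theorem mul_mul_rpow_rpow {α m u : ℝ} (hα : α < 1) (hm : 0 ≤ m) (hu : 0 ≤ u) :
    (m * u ^ (1 / (1 - α))) ^ α = m ^ α * u ^ (1 / (1 - α) - 1) := by
  rw [Real.mul_rpow hm (by positivity), ← Real.rpow_mul hu, one_div_one_sub_mul hα]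

/-- Small perturbations of `K` preserve strict inequalities for `c * K ^ α`. -/
theorem eventually_add_rpow {c α K : ℝ} (hK : 0 < K) {p : ℝ → Prop}
    (hp : ∀ᶠ y in 𝓝 (c * K ^ α), p y) :
    ∀ᶠ δ in 𝓝[>] (0 : ℝ), p (c * (K + δ) ^ α) ∧ p (c * (K - δ) ^ α) := by
  refine Eventually.filter_mono nhdsWithin_le_nhds (Eventually.and ?_ ?_)
  · have : ContinuousAt (fun δ : ℝ => c * (K + δ) ^ α) 0 := by
      refine continuousAt_const.mul (ContinuousAt.rpow_const (by fun_prop) (Or.inl ?_))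
      simpa using hK.ne'
    have h := this.tendsto
    simp only [add_zero] at h
    exact h.eventually hp
  · have : ContinuousAt (fun δ : ℝ => c * (K - δ) ^ α) 0 := by
      refine continuousAt_const.mul (ContinuousAt.rpow_const (by fun_prop) (Or.inl ?_))
      simpa using hK.ne'
    have h := this.tendsto
    simp only [sub_zero] at h
    exact h.eventually hp

theorem integral_add_rpow {γ s t r m : ℝ} (hγ : 0 < γ) :
    IntervalIntegrable (fun u => m * γ * (u + r) ^ (γ - 1)) volume s t ∧
      ∫ u in s..t, m * γ * (u + r) ^ (γ - 1) = m * ((t + r) ^ γ - (s + r) ^ γ) := by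
  have h : IntervalIntegrable (fun u : ℝ => u ^ (γ - 1)) volume (s + r) (t + r) :=
    intervalIntegral.intervalIntegrable_rpow' (by linarith)
  refine ⟨IntervalIntegrable.const_mul ?_ _, ?_⟩
  · simpa using h.comp_add_right r
  · rw [intervalIntegral.integral_const_mul,
      intervalIntegral.integral_comp_add_right (fun u => u ^ (γ - 1)) r,
      integral_rpow (Or.inl (by linarith))]
    rw [sub_add_cancel, mul_assoc, mul_div_cancel₀ _ hγ.ne']

theorem integral_le_of_le_rpow {f : ℝ → ℝ} {γ s t r m : ℝ} (hf : IntervalIntegrable f volume s t)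
    (hγ : 0 < γ) (hst : s ≤ t) (h : ∀ u ∈ Set.Ioo s t, f u ≤ m * γ * (u + r) ^ (γ - 1)) :
    ∫ u in s..t, f u ≤ m * ((t + r) ^ γ - (s + r) ^ γ) := by
  obtain ⟨h1, h2⟩ := integral_add_rpow (s := s) (t := t) (r := r) (m := m) hγ
  rw [← h2]
  exact intervalIntegral.integral_mono_on_of_le_Ioo hst hf h1 h

theorem le_integral_of_rpow_le {f : ℝ → ℝ} {γ s t r m : ℝ} (hf : IntervalIntegrable f volume s t)
    (hγ : 0 < γ) (hst : s ≤ t) (h : ∀ u ∈ Set.Ioo s t, m * γ * (u + r) ^ (γ - 1) ≤ f u) :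
    m * ((t + r) ^ γ - (s + r) ^ γ) ≤ ∫ u in s..t, f u := by
  obtain ⟨h1, h2⟩ := integral_add_rpow (s := s) (t := t) (r := r) (m := m) hγ
  rw [← h2]
  exact intervalIntegral.integral_mono_on_of_le_Ioo hst h1 hf h

/-! ### Barriers -/

/-- Before a point where a continuous function is positive, either it is positive throughout or
there is a last point where it is nonpositive, and there it vanishes. -/
theorem exists_last_zero {D : ℝ → ℝ} (hD : Continuous D) {s t : ℝ} (hst : s ≤ t) (hs : D s ≤ 0)
    (ht : 0 < D t) : ∃ z, s ≤ z ∧ z < t ∧ D z = 0 ∧ ∀ u, z < u → u ≤ t → 0 < D u := by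
  set S := Set.Icc s t ∩ D ⁻¹' Set.Iic 0 with hS
  have hc : IsCompact S := isCompact_Icc.inter_right (isClosed_Iic.preimage hD)
  have hz := hc.sSup_mem ⟨s, ⟨le_rfl, hst⟩, hs⟩
  set z := sSup S
  have hpos : ∀ u, z < u → u ≤ t → 0 < D u := by
    intro u hu hut
    by_contra! hneg
    exact absurd (le_csSup hc.bddAbove (show u ∈ S from ⟨⟨hz.1.1.trans hu.le, hut⟩, hneg⟩))
      (not_le.2 hu)
  have hzt : z < t := lt_of_le_of_ne hz.1.2 fun h => absurd hz.2 (by simp [h, ht])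
  refine ⟨z, hz.1.1, hzt, le_antisymm hz.2 ?_, hpos⟩
  have : Tendsto D (𝓝[>] z) (𝓝 (D z)) := hD.continuousAt.tendsto.mono_left nhdsWithin_le_nhds
  refine ge_of_tendsto this ?_
  filter_upwards [Ioc_mem_nhdsGT hzt] with u hu
  exact (hpos u hu.1 hu.2).le

/-- Continuous induction: at the first point where D is nonpositive, D is nonnegative on everything
before it, so the hypothesis makes D positive there. -/
theorem pos_of_forall_nonneg {D : ℝ → ℝ} (hD : Continuous D) {a : ℝ} (ha : 0 < D a)
    (h : ∀ t, a ≤ t → (∀ s, a ≤ s → s ≤ t → 0 ≤ D s) → 0 < D t) : ∀ t, a ≤ t → 0 < D t := by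
  by_contra! hcon
  obtain ⟨t, hat, ht⟩ := hcon
  set S := Set.Icc a t ∩ D ⁻¹' Set.Iic 0 with hS
  have hc : IsCompact S := isCompact_Icc.inter_right (isClosed_Iic.preimage hD)
  have hz := hc.sInf_mem ⟨t, ⟨hat, le_rfl⟩, ht⟩
  set z := sInf S
  have hpos : ∀ u, a ≤ u → u < z → 0 < D u := by
    intro u hu huz
    by_contra! hneg
    exact absurd (csInf_le hc.bddBelow (show u ∈ S from ⟨⟨hu, huz.le.trans hz.1.2⟩, hneg⟩))
      (not_le.2 huz)
  have haz : a < z := lt_of_le_of_ne hz.1.1 fun h => absurd hz.2 (by simp [← h, ha])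
  have h0 : 0 ≤ D z := by
    have : Tendsto D (𝓝[<] z) (𝓝 (D z)) := hD.continuousAt.tendsto.mono_left nhdsWithin_le_nhds
    refine ge_of_tendsto this ?_
    filter_upwards [Ico_mem_nhdsLT haz] with u hu
    exact (hpos u hu.1 hu.2).le
  refine absurd (h z haz.le fun s has hsz => ?_) (not_lt.2 hz.2)
  rcases hsz.lt_or_eq with h' | rfl
  · exact (hpos s has h').le
  · exact h0

/-! ### Equations with the power drift on the positive half-line -/

/-- `x = ∫₀ f + b` on `[0,∞)`, where `f = c x ^ α` whenever `x` is positive. -/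
structure HasPowerDrift (c α : ℝ) (x f b : ℝ → ℝ) : Prop where
  integrable : ∀ s t, IntervalIntegrable f volume s t
  eq : ∀ t, 0 ≤ t → x t = (∫ u in (0 : ℝ)..t, f u) + b t
  drift : ∀ t, 0 ≤ t → 0 < x t → f t = c * x t ^ α

/-- `b(t) = o(t ^ γ)`. -/
def IsSmall (γ : ℝ) (b : ℝ → ℝ) : Prop := ∀ δ > 0, ∀ᶠ t in atTop, |b t| ≤ δ * t ^ γ

section

variable {c α : ℝ} {x f b : ℝ → ℝ}

theorem HasPowerDrift.continuous (h : HasPowerDrift c α x f b) :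
    Continuous fun t => ∫ u in (0 : ℝ)..t, f u :=
  intervalIntegral.continuous_primitive h.integrable 0

theorem HasPowerDrift.integral_sub (h : HasPowerDrift c α x f b) (s t : ℝ) :
    (∫ u in (0 : ℝ)..t, f u) - ∫ u in (0 : ℝ)..s, f u = ∫ u in s..t, f u :=
  intervalIntegral.integral_interval_sub_left (h.integrable _ _) (h.integrable _ _)

theorem tendsto_rpow_one_div (hα : α < 1) :
    Tendsto (fun t : ℝ => t ^ (1 / (1 - α))) atTop atTop :=
  tendsto_rpow_atTop (one_div_pos.2 (by linarith))

/-- Upper bound for a nonincreasing drift. -/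
theorem HasPowerDrift.eventually_le_of_nonpos (h : HasPowerDrift c α x f b) (hc : 0 < c)
    (hα : α ≤ 0) (hb : IsSmall (1 / (1 - α)) b) (hx : ∀ᶠ t in atTop, 0 < x t) {K : ℝ}
    (hK : (c * (1 - α)) ^ (1 / (1 - α)) < K) :
    ∀ᶠ t in atTop, x t ≤ K * t ^ (1 / (1 - α)) := by
  have hα1 : α < 1 := by linarith
  set γ := 1 / (1 - α) with hγdef
  have hγ : 0 < γ := one_div_pos.2 (by linarith)
  obtain ⟨K₁, hK₁, hK₁K⟩ := exists_between hK
  have hK₁0 : 0 < K₁ := lt_of_le_of_lt (by have : 0 < 1 - α := by linarith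
                                           positivity) hK₁
  have hlt := mul_rpow_lt_of_lt hc hα1 hK₁
  rw [← hγdef] at hlt
  obtain ⟨δ, ⟨⟨-, hδ⟩, hδK₁, hδK⟩, hδ0⟩ := (((eventually_add_rpow hK₁0
    (eventually_lt_nhds hlt)).and ((eventually_lt_nhds hK₁0).filter_mono
      nhdsWithin_le_nhds |>.and ((eventually_lt_nhds (sub_pos.2 hK₁K)).filter_mono
      nhdsWithin_le_nhds))).and self_mem_nhdsWithin).exists
  -- Where A > K₁ u ^ γ, the solution exceeds (K₁ - δ) u ^ γ, so the nonincreasing drift is at most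
  -- m γ u ^ (γ - 1). Thus A grows no faster than m t ^ γ with m < K₁.
  set m := c * (K₁ - δ) ^ α / γ with hm
  have hmγ : m * γ = c * (K₁ - δ) ^ α := div_mul_cancel₀ _ hγ.ne'
  have hmK : m < K₁ := by rwa [hm, div_lt_iff₀ hγ]
  set A : ℝ → ℝ := fun t => ∫ u in (0 : ℝ)..t, f u with hA
  obtain ⟨T, hT1, hT⟩ : ∃ T : ℝ, 1 ≤ T ∧ ∀ t, T ≤ t → 0 < x t ∧ |b t| ≤ δ * t ^ γ := by
    obtain ⟨T, hT⟩ := eventually_atTop.1 (hx.and (hb δ hδ0))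
    exact ⟨max T 1, le_max_right _ _, fun t ht => hT t ((le_max_left _ _).trans ht)⟩
  have hinc : ∀ s t, T ≤ s → s ≤ t → (∀ u, s < u → u < t → 0 < A u - K₁ * u ^ γ) →
      A t - A s ≤ m * (t ^ γ - s ^ γ) := by
    intro s t hs hst hpos
    have h1 := integral_le_of_le_rpow (r := 0) (m := m) (h.integrable s t) hγ hst ?_
    · simp only [add_zero] at h1
      rwa [← h.integral_sub] at h1
    · intro u hu
      have hTu : T ≤ u := hs.trans hu.1.le
      have hu0 : 0 < u := by linarith
      obtain ⟨hxu, hbu⟩ := hT u hTu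
      rw [h.drift u hu0.le hxu, hmγ, add_zero, mul_assoc, ← mul_mul_rpow_rpow hα1
        (by linarith) hu0.le]
      refine mul_le_mul_of_nonneg_left (Real.rpow_le_rpow_of_nonpos ?_ ?_ hα) hc.le
      · have : 0 < K₁ - δ := by linarith
        positivity
      · have h2 := hpos u hu.1 hu.2
        have h3 : x u = A u + b u := h.eq u hu0.le
        rw [h3, sub_mul]
        linarith [(abs_le.1 hbu).1]
  have hDc : Continuous fun t => A t - K₁ * t ^ γ :=
    h.continuous.sub (continuous_const.mul (Real.continuous_rpow_const hγ.le))
  -- Growth at the smaller rate m cannot stay above the barrier forever, so A meets it; afterwards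
  -- the same estimate forbids an upward crossing.
  have key : ∃ s, T ≤ s ∧ A s - K₁ * s ^ γ ≤ 0 := by
    by_contra! hcon
    obtain ⟨t, htT, ht⟩ := ((eventually_ge_atTop T).and ((tendsto_rpow_one_div hα1).eventually
      (eventually_gt_atTop ((A T - m * T ^ γ) / (K₁ - m))))).exists
    rw [← hγdef, div_lt_iff₀ (by linarith)] at ht
    have := hinc T t le_rfl htT fun u hu _ => hcon u hu.le
    have := hcon t htT
    linarith
  obtain ⟨s, hTs, hs⟩ := key
  filter_upwards [eventually_ge_atTop s] with t hst
  have ht0 : 0 < t := by linarith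
  have hDt : A t - K₁ * t ^ γ ≤ 0 := by
    by_contra! hDt
    obtain ⟨z, hsz, hzt, hz, hpos⟩ := exists_last_zero hDc hst hs hDt
    have h1 := hinc z t (hTs.trans hsz) hzt.le fun u hu hu' => hpos u hu hu'.le
    have h2 : z ^ γ < t ^ γ := Real.rpow_lt_rpow (by linarith) hzt hγ
    have h3 : 0 < (K₁ - m) * (t ^ γ - z ^ γ) := mul_pos (by linarith) (by linarith)
    have h4 : A z - K₁ * z ^ γ = 0 := hz
    linarith
  have h3 : x t = A t + b t := h.eq t ht0.le
  have h4 := (abs_le.1 (hT t (hTs.trans hst)).2).2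
  have h5 : 0 < t ^ γ := by positivity
  have h6 : (K₁ + δ) * t ^ γ ≤ K * t ^ γ := by gcongr; linarith
  rw [h3]
  linarith

/-- For a nonincreasing drift and `k` small enough, the integrated drift is eventually above or
eventually below `k * t ^ γ`; the second is impossible if the solution is eventually positive. -/
theorem HasPowerDrift.eventually_ge_or_lt (h : HasPowerDrift c α x f b) (hc : 0 < c)
    (hα : α ≤ 0) (hb : IsSmall (1 / (1 - α)) b) {k : ℝ} (hk0 : 0 < k)
    (hk : k < (c * (1 - α)) ^ (1 / (1 - α))) :
    (∀ᶠ t in atTop, k * t ^ (1 / (1 - α)) ≤ ∫ u in (0 : ℝ)..t, f u) ∨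
      ((∀ᶠ t in atTop, ∫ u in (0 : ℝ)..t, f u < k * t ^ (1 / (1 - α))) ∧
        ¬ ∀ᶠ t in atTop, 0 < x t) := by
  have hα1 : α < 1 := by linarith
  set γ := 1 / (1 - α) with hγdef
  have hγ : 0 < γ := one_div_pos.2 (by linarith)
  have hlt := lt_mul_rpow_of_lt hc hα1 hk0 hk
  rw [← hγdef] at hlt
  obtain ⟨δ, ⟨⟨hδ, -⟩, hδk⟩, hδ0⟩ := (((eventually_add_rpow hk0
    (eventually_gt_nhds hlt)).and ((eventually_lt_nhds hk0).filter_mono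
      nhdsWithin_le_nhds)).and self_mem_nhdsWithin).exists
  -- Where x > 0 and A < k u ^ γ, the solution is at most (k + δ) u ^ γ, so the drift is at least m
  -- γ u ^ (γ - 1), with m > k.
  set m := c * (k + δ) ^ α / γ with hm
  have hmγ : m * γ = c * (k + δ) ^ α := div_mul_cancel₀ _ hγ.ne'
  have hmk : k < m := by rwa [hm, lt_div_iff₀ hγ]
  set A : ℝ → ℝ := fun t => ∫ u in (0 : ℝ)..t, f u with hA
  obtain ⟨T, hT1, hT⟩ : ∃ T : ℝ, 1 ≤ T ∧ ∀ t, T ≤ t → |b t| ≤ δ * t ^ γ := by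
    obtain ⟨T, hT⟩ := eventually_atTop.1 (hb δ hδ0)
    exact ⟨max T 1, le_max_right _ _, fun t ht => hT t ((le_max_left _ _).trans ht)⟩
  have hinc : ∀ s t, T ≤ s → s ≤ t → (∀ u, s < u → u < t → 0 < x u ∧ A u < k * u ^ γ) →
      m * (t ^ γ - s ^ γ) ≤ A t - A s := by
    intro s t hs hst hpos
    have h1 := le_integral_of_rpow_le (r := 0) (m := m) (h.integrable s t) hγ hst ?_
    · simp only [add_zero] at h1
      rwa [← h.integral_sub] at h1
    · intro u hu
      have hTu : T ≤ u := hs.trans hu.1.le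
      have hu0 : 0 < u := by linarith
      have hbu := hT u hTu
      obtain ⟨hxu, hAu⟩ := hpos u hu.1 hu.2
      rw [h.drift u hu0.le hxu, hmγ, add_zero, mul_assoc, ← mul_mul_rpow_rpow hα1
        (by linarith) hu0.le]
      refine mul_le_mul_of_nonneg_left (Real.rpow_le_rpow_of_nonpos hxu ?_ hα) hc.le
      have h3 : x u = A u + b u := h.eq u hu0.le
      rw [h3, add_mul]
      linarith [(abs_le.1 hbu).2]
  have hpc : Continuous fun t : ℝ => t ^ γ := Real.continuous_rpow_const hγ.le
  have hDc : Continuous fun t => k * t ^ γ - A t := (continuous_const.mul hpc).sub h.continuous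
  have stay : ∀ u t, T ≤ u → u ≤ t → k * u ^ γ ≤ A u → k * t ^ γ ≤ A t := by
    intro u t hTu hut hu
    by_contra! hDt
    obtain ⟨z, huz, hzt, hz, hpos⟩ := exists_last_zero hDc hut (by linarith)
      (show 0 < k * t ^ γ - A t by linarith)
    have hz0 : 0 < z := by linarith
    have hz' : δ * z ^ γ < A z := by
      have : 0 < z ^ γ := by positivity
      have : δ * z ^ γ < k * z ^ γ := by gcongr
      linarith
    -- Below the barrier x might be negative, where the drift formula is not available. Right after
    -- the crossing point z, however, A is still above δ s ^ γ, hence x > 0, and this short interval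
    -- already gives the contradiction.
    have hev : ∀ᶠ s in 𝓝 z, δ * s ^ γ < A s :=
      (continuous_const.mul hpc).continuousAt.eventually_lt h.continuous.continuousAt hz'
    obtain ⟨ε, hε, hball⟩ := Metric.eventually_nhds_iff.1 hev
    set t' := min t (z + ε / 2)
    have hzt' : z < t' := lt_min hzt (by linarith)
    have h1 := hinc z t' (hTu.trans huz) hzt'.le fun s hs hs' => by
      have hst : s ≤ t := hs'.le.trans (min_le_left _ _)
      have hsε : s < z + ε / 2 := hs'.trans_le (min_le_right _ _)
      have h3 : x s = A s + b s := h.eq s (by linarith)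
      have h4 := hball (y := s) (by rw [Real.dist_eq, abs_lt]; constructor <;> linarith)
      have h5 := (abs_le.1 (hT s (by linarith))).1
      have h6 := hpos s hs hst
      exact ⟨by rw [h3]; linarith, by linarith⟩
    have h2 : z ^ γ < t' ^ γ := Real.rpow_lt_rpow hz0.le hzt' hγ
    have h3 : 0 < (m - k) * (t' ^ γ - z ^ γ) := mul_pos (by linarith) (by linarith)
    have h4 := hpos t' hzt' (min_le_left _ _)
    linarith
  by_cases hex : ∃ u, T ≤ u ∧ k * u ^ γ ≤ A u
  · obtain ⟨u, hTu, hu⟩ := hex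
    left
    filter_upwards [eventually_ge_atTop u] with t ht
    exact stay u t hTu ht hu
  · push Not at hex
    right
    refine ⟨(eventually_ge_atTop T).mono fun t ht => hex t ht, fun hx => ?_⟩
    obtain ⟨S, hS⟩ := eventually_atTop.1 hx
    set R := max S T
    obtain ⟨t, htR, ht⟩ := ((eventually_ge_atTop R).and ((tendsto_rpow_one_div hα1).eventually
      (eventually_gt_atTop ((m * R ^ γ - A R) / (m - k))))).exists
    rw [← hγdef, div_lt_iff₀ (by linarith)] at ht
    have h1 := hinc R t (le_max_right _ _) htR fun u hu _ =>
      ⟨hS u ((le_max_left _ _).trans hu.le), hex u ((le_max_right _ _).trans hu.le)⟩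
    have h2 := hex t ((le_max_right _ _).trans htR)
    linarith

theorem tendsto_add_rpow_div {γ : ℝ} (r : ℝ) :
    Tendsto (fun t : ℝ => (t + r) ^ γ / t ^ γ) atTop (𝓝 1) := by
  have h1 : Tendsto (fun t : ℝ => 1 + r / t) atTop (𝓝 1) := by
    simpa using tendsto_const_nhds.add (tendsto_const_nhds (x := r).div_atTop tendsto_id)
  have h2 := h1.rpow_const (p := γ) (Or.inl one_ne_zero)
  rw [Real.one_rpow] at h2
  refine h2.congr' ?_
  filter_upwards [eventually_gt_atTop 0, eventually_gt_atTop (-r)] with t ht htr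
  rw [← Real.div_rpow (by linarith) ht.le, add_div, div_self ht.ne']

/-- Upper bound for a nondecreasing drift. -/
theorem HasPowerDrift.eventually_le_of_nonneg (h : HasPowerDrift c α x f b) (hc : 0 < c)
    (hα : 0 ≤ α) (hα1 : α < 1) (hb : IsSmall (1 / (1 - α)) b) (hx : ∀ᶠ t in atTop, 0 < x t)
    {K : ℝ} (hK : (c * (1 - α)) ^ (1 / (1 - α)) < K) :
    ∀ᶠ t in atTop, x t ≤ K * t ^ (1 / (1 - α)) := by
  set γ := 1 / (1 - α) with hγdef
  have hγ : 0 < γ := one_div_pos.2 (by linarith)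
  obtain ⟨K₁, hK₁, hK₁K⟩ := exists_between hK
  have hK₁0 : 0 < K₁ := lt_of_le_of_lt (by have : 0 < 1 - α := by linarith
                                           positivity) hK₁
  have hlt := mul_rpow_lt_of_lt hc hα1 hK₁
  rw [← hγdef] at hlt
  obtain ⟨δ, ⟨⟨hδ, -⟩, hδK⟩, hδ0⟩ := (((eventually_add_rpow hK₁0
    (eventually_lt_nhds hlt)).and ((eventually_lt_nhds (sub_pos.2 hK₁K)).filter_mono
      nhdsWithin_le_nhds)).and self_mem_nhdsWithin).exists
  set m := c * (K₁ + δ) ^ α / γ with hm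
  have hmγ : m * γ = c * (K₁ + δ) ^ α := div_mul_cancel₀ _ hγ.ne'
  have hmK : m < K₁ := by rwa [hm, div_lt_iff₀ hγ]
  set A : ℝ → ℝ := fun t => ∫ u in (0 : ℝ)..t, f u with hA
  obtain ⟨T, hT1, hT⟩ : ∃ T : ℝ, 1 ≤ T ∧ ∀ t, T ≤ t → 0 < x t ∧ |b t| ≤ δ * t ^ γ := by
    obtain ⟨T, hT⟩ := eventually_atTop.1 (hx.and (hb δ hδ0))
    exact ⟨max T 1, le_max_right _ _, fun t ht => hT t ((le_max_left _ _).trans ht)⟩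
  -- A nondecreasing drift need not bring A back below a barrier. So the barrier is shifted in time
  -- until it starts above A; the shift does not change its leading order.
  obtain ⟨r, hr0, hr⟩ : ∃ r : ℝ, 0 ≤ r ∧ A T < K₁ * (T + r) ^ γ := by
    obtain ⟨r, hr0, hr⟩ := ((eventually_ge_atTop (0 : ℝ)).and (((tendsto_rpow_one_div hα1).comp
      (tendsto_atTop_add_const_left atTop T tendsto_id)).eventually
      (eventually_gt_atTop (A T / K₁)))).exists
    refine ⟨r, hr0, ?_⟩
    rw [div_lt_iff₀ hK₁0, mul_comm] at hr
    exact hr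
  have hDc : Continuous fun t => K₁ * (t + r) ^ γ - A t :=
    (continuous_const.mul ((Real.continuous_rpow_const hγ.le).comp (continuous_add_const r))).sub
      h.continuous
  have hD : ∀ t, T ≤ t → 0 < K₁ * (t + r) ^ γ - A t := by
    refine pos_of_forall_nonneg hDc (by linarith) fun t hTt hpos => ?_
    have h1 := integral_le_of_le_rpow (r := r) (m := m) (h.integrable T t) hγ hTt ?_
    · rw [← h.integral_sub] at h1
      have h2 : (T + r) ^ γ ≤ (t + r) ^ γ := by gcongr
      have h3 : 0 ≤ (K₁ - m) * ((t + r) ^ γ - (T + r) ^ γ) :=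
        mul_nonneg (by linarith) (by linarith)
      have h4 : A t - A T ≤ m * ((t + r) ^ γ - (T + r) ^ γ) := h1
      linarith
    · intro u hu
      have hu0 : 0 < u := by linarith [hu.1]
      obtain ⟨hxu, hbu⟩ := hT u hu.1.le
      rw [h.drift u hu0.le hxu, hmγ, mul_assoc, ← mul_mul_rpow_rpow hα1
        (by linarith) (by linarith)]
      refine mul_le_mul_of_nonneg_left (Real.rpow_le_rpow hxu.le ?_ hα) hc.le
      have h2 := hpos u hu.1.le hu.2.le
      have h3 : x u = A u + b u := h.eq u hu0.le
      have h4 : δ * u ^ γ ≤ δ * (u + r) ^ γ := by gcongr; linarith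
      rw [h3, add_mul]
      linarith [(abs_le.1 hbu).2]
  have hlim : Tendsto (fun t : ℝ => K₁ * ((t + r) ^ γ / t ^ γ) + δ) atTop (𝓝 (K₁ * 1 + δ)) :=
    ((tendsto_add_rpow_div r).const_mul K₁).add_const δ
  filter_upwards [eventually_ge_atTop T, hlim.eventually (eventually_lt_nhds
    (show K₁ * 1 + δ < K by linarith))] with t hTt ht
  have ht0 : 0 < t := by linarith
  have h3 : x t = A t + b t := h.eq t ht0.le
  have h4 := (abs_le.1 (hT t hTt).2).2
  have h5 : 0 < t ^ γ := by positivity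
  have h6 := mul_lt_mul_of_pos_right ht h5
  rw [add_mul, mul_assoc, div_mul_cancel₀ _ h5.ne'] at h6
  rw [h3]
  linarith [hD t hTt]

/-- Lower bound for a nondecreasing drift, after a time when the solution is large compared with
the later increments of the noise. -/
theorem HasPowerDrift.le_of_nonneg (h : HasPowerDrift c α x f b) (hc : 0 < c)
    (hα : 0 ≤ α) (hα1 : α < 1) {k : ℝ} (hk0 : 0 < k) (hk : k < (c * (1 - α)) ^ (1 / (1 - α))) :
    ∀ᶠ δ in 𝓝[>] (0 : ℝ), ∀ τ S : ℝ, 0 ≤ τ → 0 < S →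
      (∀ t, S ≤ t → |b (τ + t) - b τ| ≤ δ * t ^ (1 / (1 - α))) →
      (k + δ) * S ^ (1 / (1 - α)) < x (τ + S) →
      ∀ t, τ + S ≤ t → (k - δ) * (t + -τ) ^ (1 / (1 - α)) ≤ x t := by
  set γ := 1 / (1 - α) with hγdef
  have hγ : 0 < γ := one_div_pos.2 (by linarith)
  have hlt := lt_mul_rpow_of_lt hc hα1 hk0 hk
  rw [← hγdef] at hlt
  filter_upwards [eventually_add_rpow hk0 (eventually_gt_nhds hlt),
    (eventually_lt_nhds hk0).filter_mono nhdsWithin_le_nhds, self_mem_nhdsWithin]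
    with δ hδ' hδk hδ0 τ S hτ hS hbS hxS
  have hδ := hδ'.2
  rw [Set.mem_Ioi] at hδ0
  set m := c * (k - δ) ^ α / γ with hm
  have hmγ : m * γ = c * (k - δ) ^ α := div_mul_cancel₀ _ hγ.ne'
  have hmk : k < m := by rwa [hm, lt_div_iff₀ hγ]
  set A : ℝ → ℝ := fun t => ∫ u in (0 : ℝ)..t, f u with hA
  have hbd : ∀ t, τ + S ≤ t → |b t - b τ| ≤ δ * (t + -τ) ^ γ := by
    intro t ht
    have := hbS (t + -τ) (by linarith)
    rwa [show τ + (t + -τ) = t by ring] at this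
  -- The barrier is compared with A + b τ rather than A: its distance to x is then the increment b t
  -- - b τ, the only quantity controlled here.
  have hDc : Continuous fun t => A t + b τ - k * (t + -τ) ^ γ :=
    (h.continuous.add_const _).sub
      (continuous_const.mul ((Real.continuous_rpow_const hγ.le).comp (continuous_add_const (-τ))))
  have hxD : ∀ t, τ + S ≤ t → 0 ≤ A t + b τ - k * (t + -τ) ^ γ →
      (k - δ) * (t + -τ) ^ γ ≤ x t := by
    intro t ht hDt
    have h3 : x t = A t + b t := h.eq t (by linarith)
    rw [h3, sub_mul]
    linarith [(abs_le.1 (hbd t ht)).1]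
  have hD : ∀ t, τ + S ≤ t → 0 < A t + b τ - k * (t + -τ) ^ γ := by
    refine pos_of_forall_nonneg hDc ?_ fun t hTt hpos => ?_
    · have h3 : x (τ + S) = A (τ + S) + b (τ + S) := h.eq _ (by linarith)
      have h4 := hbd _ le_rfl
      rw [show τ + S + -τ = S by ring] at h4 ⊢
      rw [h3, add_mul] at hxS
      linarith [(abs_le.1 h4).2]
    have h1 := le_integral_of_rpow_le (r := -τ) (m := m) (h.integrable (τ + S) t) hγ hTt ?_
    · rw [← h.integral_sub] at h1
      have h2 : (τ + S + -τ) ^ γ ≤ (t + -τ) ^ γ :=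
        Real.rpow_le_rpow (by linarith) (by linarith) hγ.le
      have h3 : 0 ≤ (m - k) * ((t + -τ) ^ γ - (τ + S + -τ) ^ γ) :=
        mul_nonneg (by linarith) (by linarith)
      have h4 : m * ((t + -τ) ^ γ - (τ + S + -τ) ^ γ) ≤ A t - A (τ + S) := h1
      have h3' : x (τ + S) = A (τ + S) + b (τ + S) := h.eq _ (by linarith)
      have h4' := hbd _ le_rfl
      rw [h3', add_mul] at hxS
      rw [show τ + S + -τ = S by ring] at h3 h4 h4'
      linarith [(abs_le.1 h4').2]
    · intro u hu
      have hu0 : 0 < u := by linarith [hu.1]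
      have huτ : 0 < u + -τ := by linarith [hu.1]
      have h2 := hxD u hu.1.le (hpos u hu.1.le hu.2.le)
      have hkδ : 0 < k - δ := by linarith
      have hxu : 0 < x u := lt_of_lt_of_le (by positivity) h2
      rw [h.drift u hu0.le hxu, hmγ, mul_assoc, ← mul_mul_rpow_rpow hα1 hkδ.le huτ.le]
      exact mul_le_mul_of_nonneg_left (Real.rpow_le_rpow (by positivity) h2 hα) hc.le
  exact fun t ht => hxD t ht (hD t ht).le

end
end SmallNoise

namespace SmallNoise

/-! ### Asymptotics of solutions -/

/-- There are arbitrarily late times `τ` after which the increments of `b` are `o(t ^ γ)`,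
uniformly in `τ`. -/
def HasSmallIncrements (γ : ℝ) (b : ℝ → ℝ) : Prop :=
  ∀ δ > 0, ∃ S > 0, ∀ M, ∃ τ, 0 ≤ τ ∧ M ≤ τ ∧ ∀ t, S ≤ t → |b (τ + t) - b τ| ≤ δ * t ^ γ

theorem IsSmall.neg {γ : ℝ} {b : ℝ → ℝ} (h : IsSmall γ b) : IsSmall γ (-b) := by
  intro δ hδ
  simpa using h δ hδ

theorem HasSmallIncrements.neg {γ : ℝ} {b : ℝ → ℝ} (h : HasSmallIncrements γ b) :
    HasSmallIncrements γ (-b) := by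
  intro δ hδ
  obtain ⟨S, hS, h⟩ := h δ hδ
  refine ⟨S, hS, fun M => ?_⟩
  obtain ⟨τ, h0, hM, h⟩ := h M
  refine ⟨τ, h0, hM, fun t ht => ?_⟩
  have := h t ht
  rwa [Pi.neg_apply, Pi.neg_apply, ← abs_neg, show -(-b (τ + t) - -b τ) = b (τ + t) - b τ by ring]

theorem HasSmallIncrements.isSmall {γ : ℝ} (hγ : 0 < γ) {b : ℝ → ℝ}
    (h : HasSmallIncrements γ b) : IsSmall γ b := by
  intro δ hδ
  obtain ⟨S, hS, h⟩ := h (δ / 2) (half_pos hδ)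
  obtain ⟨τ, h0, -, h⟩ := h 0
  filter_upwards [eventually_ge_atTop (τ + S),
    (tendsto_rpow_atTop hγ).eventually (eventually_ge_atTop (|b τ| / (δ / 2)))] with t ht ht'
  rw [div_le_iff₀ (by positivity)] at ht'
  have h1 := h (t - τ) (by linarith)
  rw [add_sub_cancel] at h1
  have h2 : (t - τ) ^ γ ≤ t ^ γ := Real.rpow_le_rpow (by linarith) (by linarith) hγ.le
  have h3 : δ / 2 * (t - τ) ^ γ ≤ δ / 2 * t ^ γ := by gcongr
  have h4 : |b t| ≤ |b t - b τ| + |b τ| := by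
    simpa using abs_add_le (b t - b τ) (b τ)
  linarith

theorem tendsto_div_rpow_of_bounds {γ κ : ℝ} {x : ℝ → ℝ}
    (hle : ∀ K, κ < K → ∀ᶠ t in atTop, x t ≤ K * t ^ γ)
    (hge : ∀ k, k < κ → ∀ᶠ t in atTop, k * t ^ γ ≤ x t) :
    Tendsto (fun t => x t / t ^ γ) atTop (𝓝 κ) := by
  refine tendsto_order.2 ⟨fun k hk => ?_, fun K hK => ?_⟩
  · obtain ⟨k', h1, h2⟩ := exists_between hk
    filter_upwards [hge k' h2, eventually_gt_atTop 0] with t ht h0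
    have : 0 < t ^ γ := by positivity
    exact h1.trans_le ((le_div_iff₀ this).2 ht)
  · obtain ⟨K', h1, h2⟩ := exists_between hK
    filter_upwards [hle K' h1, eventually_gt_atTop 0] with t ht h0
    have : 0 < t ^ γ := by positivity
    exact ((div_le_iff₀ this).2 ht).trans_lt h2

theorem tendsto_atTop_of_rpow_le {γ k : ℝ} (hγ : 0 < γ) (hk : 0 < k) {x : ℝ → ℝ}
    (h : ∀ᶠ t in atTop, k * t ^ γ ≤ x t) : Tendsto x atTop atTop :=
  tendsto_atTop_mono' _ h ((tendsto_rpow_atTop hγ).const_mul_atTop hk)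

section

variable {c α : ℝ} {x f b : ℝ → ℝ}

/-- Eventual positivity of x rules out the second branch of `HasPowerDrift.eventually_ge_or_lt`, so
the lower barrier holds for every constant in (0, κ). -/
theorem HasPowerDrift.tendsto_of_nonpos (h : HasPowerDrift c α x f b) (hc : 0 < c)
    (hα : α ≤ 0) (hb : IsSmall (1 / (1 - α)) b) (hx : Tendsto x atTop atTop) :
    Tendsto (fun t => x t / t ^ (1 / (1 - α))) atTop (𝓝 ((c * (1 - α)) ^ (1 / (1 - α)))) := by
  have hpos := hx.eventually (eventually_gt_atTop 0)
  have hκ : 0 < (c * (1 - α)) ^ (1 / (1 - α)) := by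
    have : 0 < 1 - α := by linarith
    positivity
  refine tendsto_div_rpow_of_bounds (fun K => h.eventually_le_of_nonpos hc hα hb hpos)
    fun k hk => ?_
  obtain ⟨k', h1, h2⟩ := exists_between (max_lt hk hκ)
  have hk'0 : 0 < k' := (le_max_right _ _).trans_lt h1
  have hkk' : k < k' := (le_max_left _ _).trans_lt h1
  have h3 := (h.eventually_ge_or_lt hc hα hb hk'0 h2).resolve_right fun h' => h'.2 hpos
  filter_upwards [h3, hb (k' - k) (by linarith), eventually_ge_atTop 0] with t ht hbt h0
  rw [h.eq t h0]
  linarith [(abs_le.1 hbt).1]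

/-- In the first branch of the dichotomy x would dominate a positive multiple of t ^ γ and diverge.
So the second holds, for arbitrarily small k. -/
theorem HasPowerDrift.eventually_le_of_not_tendsto (h : HasPowerDrift c α x f b) (hc : 0 < c)
    (hα : α ≤ 0) (hb : IsSmall (1 / (1 - α)) b) (hx : ¬ Tendsto x atTop atTop) {K : ℝ}
    (hK : 0 < K) : ∀ᶠ t in atTop, x t ≤ K * t ^ (1 / (1 - α)) := by
  have hγ : 0 < 1 / (1 - α) := one_div_pos.2 (by linarith)
  have hκ : 0 < (c * (1 - α)) ^ (1 / (1 - α)) := by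
    have : 0 < 1 - α := by linarith
    positivity
  obtain ⟨k, hk0, hk⟩ := exists_between (lt_min (half_pos hK) hκ)
  rcases h.eventually_ge_or_lt hc hα hb hk0 (hk.trans_le (min_le_right _ _)) with h1 | ⟨h1, -⟩
  · refine absurd (tendsto_atTop_of_rpow_le hγ (half_pos hk0) ?_) hx
    filter_upwards [h1, hb (k / 2) (half_pos hk0), eventually_ge_atTop 0] with t ht hbt h0
    rw [h.eq t h0]
    linarith [(abs_le.1 hbt).1]
  · filter_upwards [h1, hb (K / 2) (half_pos hK), eventually_ge_atTop 0] with t ht hbt h0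
    have : k * t ^ (1 / (1 - α)) ≤ K / 2 * t ^ (1 / (1 - α)) := by
      gcongr
      exact (hk.trans_le (min_le_left _ _)).le
    rw [h.eq t h0]
    linarith [(abs_le.1 hbt).2]

/-- The waiting time S depends on δ but not on τ. As x → ∞, τ can be taken so late that x (τ + S)
passes the fixed threshold of `HasPowerDrift.le_of_nonneg`; the shift by τ disappears in the limit.
-/
theorem HasPowerDrift.tendsto_of_pos (h : HasPowerDrift c α x f b) (hc : 0 < c)
    (hα : 0 < α) (hα1 : α < 1) (hb : HasSmallIncrements (1 / (1 - α)) b)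
    (hx : Tendsto x atTop atTop) :
    Tendsto (fun t => x t / t ^ (1 / (1 - α))) atTop (𝓝 ((c * (1 - α)) ^ (1 / (1 - α)))) := by
  have hγ : 0 < 1 / (1 - α) := one_div_pos.2 (by linarith)
  have hpos := hx.eventually (eventually_gt_atTop 0)
  have hκ : 0 < (c * (1 - α)) ^ (1 / (1 - α)) := by
    have : 0 < 1 - α := by linarith
    positivity
  refine tendsto_div_rpow_of_bounds
    (fun K => h.eventually_le_of_nonneg hc hα.le hα1 (hb.isSmall hγ) hpos) fun k hk => ?_
  obtain ⟨k', h1, h2⟩ := exists_between (max_lt hk hκ)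
  have hk'0 : 0 < k' := (le_max_right _ _).trans_lt h1
  have hkk' : k < k' := (le_max_left _ _).trans_lt h1
  obtain ⟨δ, ⟨hδ, hδk⟩, hδ0⟩ := (((h.le_of_nonneg hc hα.le hα1 hk'0 h2).and
    ((eventually_lt_nhds (sub_pos.2 hkk')).filter_mono nhdsWithin_le_nhds)).and
    self_mem_nhdsWithin).exists
  obtain ⟨S, hS, hb'⟩ := hb δ hδ0
  obtain ⟨M, hM⟩ := eventually_atTop.1
    (hx.eventually (eventually_gt_atTop ((k' + δ) * S ^ (1 / (1 - α)))))
  obtain ⟨τ, hτ0, hMτ, hτ⟩ := hb' M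
  have h3 := hδ τ S hτ0 hS hτ (hM _ (by linarith))
  have hlim := (tendsto_add_rpow_div (γ := 1 / (1 - α)) (-τ)).const_mul (k' - δ)
  filter_upwards [eventually_ge_atTop (τ + S), eventually_gt_atTop 0,
    hlim.eventually (eventually_gt_nhds (show k < (k' - δ) * 1 by linarith))] with t ht ht0 ht'
  have h5 : 0 < t ^ (1 / (1 - α)) := by positivity
  have h6 := mul_lt_mul_of_pos_right ht' h5
  rw [mul_assoc, div_mul_cancel₀ _ h5.ne'] at h6
  exact h6.le.trans (h3 t ht)

/-- At one late time τ + S either x or -x is above the threshold, and the lower barrier then drives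
that one to infinity. Increments of b and -b have equal size, so the same τ serves both signs. -/
theorem HasPowerDrift.tendsto_or_of_pos {c' : ℝ} (h : HasPowerDrift c α x f b)
    (h' : HasPowerDrift c' α (-x) (-f) (-b)) (hc : 0 < c) (hc' : 0 < c')
    (hα : 0 < α) (hα1 : α < 1) (hb : HasSmallIncrements (1 / (1 - α)) b)
    (hx : Tendsto (fun t => |x t|) atTop atTop) :
    Tendsto x atTop atTop ∨ Tendsto (-x) atTop atTop := by
  have hγ : 0 < 1 / (1 - α) := one_div_pos.2 (by linarith)
  have hκ : ∀ c : ℝ, 0 < c → 0 < (c * (1 - α)) ^ (1 / (1 - α)) := by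
    intro c hc
    have : 0 < 1 - α := by linarith
    positivity
  obtain ⟨k, hk0, hk⟩ := exists_between (lt_min (hκ c hc) (hκ c' hc'))
  obtain ⟨δ, ⟨⟨hδ, hδ'⟩, hδk⟩, hδ0⟩ :=
    ((((h.le_of_nonneg hc hα.le hα1 hk0 (hk.trans_le (min_le_left _ _))).and
    (h'.le_of_nonneg hc' hα.le hα1 hk0 (hk.trans_le (min_le_right _ _)))).and
    ((eventually_lt_nhds hk0).filter_mono nhdsWithin_le_nhds)).and
    self_mem_nhdsWithin).exists
  obtain ⟨S, hS, hb'⟩ := hb δ hδ0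
  obtain ⟨M, hM⟩ := eventually_atTop.1
    (hx.eventually (eventually_gt_atTop ((k + δ) * S ^ (1 / (1 - α)))))
  obtain ⟨τ, hτ0, hMτ, hτ⟩ := hb' M
  have aux : ∀ y : ℝ → ℝ, (∀ t, τ + S ≤ t → (k - δ) * (t + -τ) ^ (1 / (1 - α)) ≤ y t) →
      Tendsto y atTop atTop := by
    intro y hy
    refine tendsto_atTop_mono' _ ((eventually_ge_atTop (τ + S)).mono hy) ?_
    exact ((tendsto_rpow_atTop hγ).comp (tendsto_atTop_add_const_right _ _ tendsto_id)
      ).const_mul_atTop (by linarith)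
  rcases lt_abs.1 (hM (τ + S) (by linarith)) with h1 | h1
  · exact Or.inl (aux _ (hδ τ S hτ0 hS hτ h1))
  · refine Or.inr (aux _ (hδ' τ S hτ0 hS (fun t ht => ?_) h1))
    have := hτ t ht
    rwa [Pi.neg_apply, Pi.neg_apply, ← abs_neg,
      show -(-b (τ + t) - -b τ) = b (τ + t) - b τ by ring]

/-- The asymptotic behaviour of solutions with `|x| → ∞`. -/
theorem HasPowerDrift.asymptotics {c' : ℝ} (h : HasPowerDrift c α x f b)
    (h' : HasPowerDrift c' α (-x) (-f) (-b)) (hc : 0 < c) (hc' : 0 < c') (hα1 : α < 1)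
    (hb : (0 < α ∧ HasSmallIncrements (1 / (1 - α)) b) ∨ (α ≤ 0 ∧ IsSmall (1 / (1 - α)) b))
    (hx : Tendsto (fun t => |x t|) atTop atTop) :
    (Tendsto x atTop atTop ∧
      Tendsto (fun t => x t / t ^ (1 / (1 - α))) atTop (𝓝 ((c * (1 - α)) ^ (1 / (1 - α))))) ∨
    (Tendsto x atTop atBot ∧
      Tendsto (fun t => x t / t ^ (1 / (1 - α))) atTop (𝓝 (-(c' * (1 - α)) ^ (1 / (1 - α))))) ∨
    (α ≤ 0 ∧ ¬ Tendsto x atTop atTop ∧ ¬ Tendsto x atTop atBot ∧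
      Tendsto (fun t => x t / t ^ (1 / (1 - α))) atTop (𝓝 0)) := by
  have hneg : Tendsto (-x) atTop atTop ↔ Tendsto x atTop atBot := tendsto_neg_atTop_iff
  have hdiv : ∀ l, Tendsto (fun t => (-x) t / t ^ (1 / (1 - α))) atTop (𝓝 l) →
      Tendsto (fun t => x t / t ^ (1 / (1 - α))) atTop (𝓝 (-l)) := by
    intro l hl
    simpa [neg_div] using hl.neg
  rcases hb with ⟨hα, hb⟩ | ⟨hα, hb⟩
  · rcases h.tendsto_or_of_pos h' hc hc' hα hα1 hb hx with h1 | h1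
    · exact Or.inl ⟨h1, h.tendsto_of_pos hc hα hα1 hb h1⟩
    · exact Or.inr (Or.inl ⟨hneg.1 h1, hdiv _ (h'.tendsto_of_pos hc' hα hα1 hb.neg h1)⟩)
  · by_cases h1 : Tendsto x atTop atTop
    · exact Or.inl ⟨h1, h.tendsto_of_nonpos hc hα hb h1⟩
    by_cases h2 : Tendsto (-x) atTop atTop
    · exact Or.inr (Or.inl ⟨hneg.1 h2, hdiv _ (h'.tendsto_of_nonpos hc' hα hb.neg h2)⟩)
    refine Or.inr (Or.inr ⟨hα, h1, hneg.not.1 h2, tendsto_div_rpow_of_bounds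
      (fun K hK => h.eventually_le_of_not_tendsto hc hα hb h1 hK) fun k hk => ?_⟩)
    filter_upwards [h'.eventually_le_of_not_tendsto hc' hα hb.neg h2 (neg_pos.2 hk)] with t ht
    simp only [Pi.neg_apply] at ht
    linarith

end

/-- Rescaling a locally bounded function with power growth. -/
theorem eventually_rescale_le {γ C : ℝ} (hγ : 0 < γ) {x : ℝ → ℝ}
    (hbdd : ∀ T, ∃ M, ∀ t, 0 ≤ t → t ≤ T → |x t| ≤ M)
    (hx : Tendsto (fun t => x t / t ^ γ) atTop (𝓝 C)) (T : ℝ) {δ : ℝ} (hδ : 0 < δ) :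
    ∀ᶠ l in 𝓝[>] (0 : ℝ), ∀ t, 0 ≤ t → t ≤ T →
      |l * x (l ^ (-(1 / γ)) * t) - C * t ^ γ| ≤ δ := by
  obtain ⟨η, hη0, hη⟩ : ∃ η > 0, η * |T| ^ γ ≤ δ := by
    refine ⟨δ / (|T| ^ γ + 1), by positivity, ?_⟩
    rw [div_mul_eq_mul_div, div_le_iff₀ (by positivity)]
    nlinarith [show 0 ≤ |T| ^ γ by positivity]
  obtain ⟨S, hS⟩ := eventually_atTop.1 (Metric.tendsto_nhds.1 hx η hη0)
  set R := max S 1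
  obtain ⟨M, hM⟩ := hbdd R
  set M' := |M| + |C| * R ^ γ
  have hlim : Tendsto (fun l : ℝ => l * M') (𝓝[>] 0) (𝓝 0) := by
    have : Tendsto (fun l : ℝ => l * M') (𝓝 0) (𝓝 (0 * M')) := tendsto_id.mul_const M'
    rw [zero_mul] at this
    exact this.mono_left nhdsWithin_le_nhds
  filter_upwards [self_mem_nhdsWithin, hlim.eventually (eventually_le_nhds hδ)] with l hl hlM t h0 hT
  rw [Set.mem_Ioi] at hl
  set s := l ^ (-(1 / γ)) * t with hs
  have hs0 : 0 ≤ s := by positivity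
  have hst : l * s ^ γ = t ^ γ := by
    rw [hs, Real.mul_rpow (by positivity) h0, ← Real.rpow_mul hl.le, neg_mul,
      one_div_mul_cancel hγ.ne', Real.rpow_neg_one, ← mul_assoc, mul_inv_cancel₀ hl.ne', one_mul]
  rw [← hst, show l * x s - C * (l * s ^ γ) = l * (x s - C * s ^ γ) by ring, abs_mul, abs_of_pos hl]
  -- For rescaled times s ≤ R the difference is bounded by M' and the factor l makes it small; for s
  -- ≥ R the asymptotics of x apply.
  rcases le_total s R with hsR | hsR
  · refine le_trans ?_ hlM
    refine mul_le_mul_of_nonneg_left ((abs_sub _ _).trans ?_) hl.le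
    rw [abs_mul, abs_of_nonneg (show 0 ≤ s ^ γ by positivity)]
    have h1 := (hM s hs0 hsR).trans (le_abs_self M)
    have h2 : |C| * s ^ γ ≤ |C| * R ^ γ := by gcongr
    linarith
  · have hs1 : 0 < s := lt_of_lt_of_le one_pos ((le_max_right S 1).trans hsR)
    have h1 := hS s ((le_max_left _ _).trans hsR)
    have hsγ : 0 < s ^ γ := by positivity
    rw [Real.dist_eq] at h1
    have h2 : x s - C * s ^ γ = (x s / s ^ γ - C) * s ^ γ := by
      rw [sub_mul, div_mul_cancel₀ _ hsγ.ne']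
    rw [h2, abs_mul, abs_of_pos hsγ]
    calc l * (|x s / s ^ γ - C| * s ^ γ) ≤ l * (η * s ^ γ) := by gcongr
      _ = η * t ^ γ := by rw [← hst]; ring
      _ ≤ η * |T| ^ γ := by
        gcongr
        exact hT.trans (le_abs_self T)
      _ ≤ δ := hη

end SmallNoise

namespace SmallNoise

/-! ### Càdlàg functions -/

/-- Induction along a partition into intervals `[a, b)` of small oscillation. -/
theorem IsCadlag.induction {x : ℝ≥0 → ℝ} (hx : IsCadlag x) {δ : ℝ} (hδ : 0 < δ)
    {p : ℝ≥0 → Prop} (h0 : p 0)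
    (hstep : ∀ a b, a < b → p a → (∀ s t, a ≤ s → s < b → a ≤ t → t < b → dist (x s) (x t) ≤ δ) →
      p b) (T : ℝ≥0) : p T := by
  set S := {t | t ≤ T ∧ p t} with hS
  have hne : S.Nonempty := ⟨0, zero_le, h0⟩
  have hbdd : BddAbove S := ⟨T, fun t ht => ht.1⟩
  set s := sSup S with hs
  have hsT : s ≤ T := csSup_le hne fun t ht => ht.1
  -- The left limit at the supremum s gives small oscillation on some [c, s), so p reaches s;
  -- right-continuity then carries p beyond s unless s = T.
  have hps : p s := by
    by_contra hps
    obtain ⟨l, hl⟩ := (hx s).2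
    have hspos : 0 < s := by
      rcases eq_zero_or_pos s with h | h
      · rw [h] at hps; exact absurd h0 hps
      · exact h
    have hev := Metric.tendsto_nhds.1 hl (δ / 2) (half_pos hδ)
    obtain ⟨a, ha, hab⟩ := (mem_nhdsLT_iff_exists_Ioo_subset' hspos).1 hev
    obtain ⟨c, hcS, hac⟩ := exists_lt_of_lt_csSup hne ha
    have hcs : c < s := lt_of_le_of_ne (le_csSup hbdd hcS) fun h => hps (h ▸ hcS.2)
    refine hps (hstep c s hcs hcS.2 fun u v hu hu' hv hv' => ?_)
    have h1 : dist (x u) l < δ / 2 := hab ⟨hac.trans_le hu, hu'⟩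
    have h2 : dist (x v) l < δ / 2 := hab ⟨hac.trans_le hv, hv'⟩
    linarith [dist_triangle_right (x u) (x v) l]
  rcases hsT.lt_or_eq with hlt | heq
  · have hev := Metric.tendsto_nhds.1 (hx s).1 (δ / 2) (half_pos hδ)
    obtain ⟨b, hb, hab⟩ := (mem_nhdsGE_iff_exists_Ico_subset' hlt).1 hev
    set c := min b T
    have hsc : s < c := lt_min hb hlt
    have hpc : p c := hstep s c hsc hps fun u v hu hu' hv hv' => by
      have h1 : dist (x u) (x s) < δ / 2 := hab ⟨hu, hu'.trans_le (min_le_left _ _)⟩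
      have h2 : dist (x v) (x s) < δ / 2 := hab ⟨hv, hv'.trans_le (min_le_left _ _)⟩
      linarith [dist_triangle_right (x u) (x v) (x s)]
    exact absurd (le_csSup hbdd ⟨min_le_right _ _, hpc⟩) (not_le.2 hsc)
  · exact heq ▸ hps

theorem IsCadlag.exists_bound {x : ℝ≥0 → ℝ} (hx : IsCadlag x) (T : ℝ≥0) :
    ∃ M, ∀ t ≤ T, |x t| ≤ M := by
  obtain ⟨M, hM⟩ := hx.induction (p := fun T => ∃ M, ∀ t < T, |x t| ≤ M) one_pos
    ⟨0, fun t ht => absurd ht (not_lt.2 zero_le)⟩ (fun a b hab ⟨M, hM⟩ hosc =>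
      ⟨max M (|x a| + 1), fun t ht => by
        rcases lt_or_ge t a with h | h
        · exact (hM t h).trans (le_max_left _ _)
        · refine le_trans ?_ (le_max_right _ _)
          have := hosc t a h ht le_rfl hab
          rw [Real.dist_eq] at this
          have h3 : |x t| ≤ |x t - x a| + |x a| := by simpa using abs_add_le (x t - x a) (x a)
          linarith⟩) (T + 1)
  exact ⟨M, fun t ht => hM t (ht.trans_lt (lt_add_one T))⟩

/-- These grid points approach t from the right, so a right-continuous function is the pointwise
limit of its values along them; this gives its measurability. -/
theorem tendsto_floor_add_one_div (t : ℝ≥0) :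
    Tendsto (fun n : ℕ => ((⌊(n + 1) * t⌋₊ : ℝ≥0) + 1) / (n + 1)) atTop (𝓝[≥] t) := by
  refine tendsto_nhdsWithin_iff.2 ⟨?_, Eventually.of_forall fun n => ?_⟩
  · have h : Tendsto (fun n : ℕ => t + 1 / ((n : ℝ≥0) + 1)) atTop (𝓝 (t + 0)) := by
      refine tendsto_const_nhds.add ?_
      have := tendsto_one_div_add_atTop_nhds_zero_nat (𝕜 := ℝ≥0)
      exact this
    rw [add_zero] at h
    refine tendsto_of_tendsto_of_tendsto_of_le_of_le tendsto_const_nhds h (fun n => ?_) fun n => ?_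
    · rw [le_div_iff₀ (by positivity), mul_comm]
      exact (Nat.lt_floor_add_one _).le
    · have hn : (n : ℝ≥0) + 1 ≠ 0 := by positivity
      rw [div_le_iff₀ (by positivity), add_mul t, one_div_mul_cancel hn, mul_comm t]
      exact add_le_add_left (Nat.floor_le zero_le) 1
  · rw [Set.mem_Ici, le_div_iff₀ (by positivity), mul_comm]
    exact (Nat.lt_floor_add_one _).le

theorem IsCadlag.measurable {x : ℝ≥0 → ℝ} (hx : IsCadlag x) : Measurable x := by
  refine measurable_of_tendsto_metrizable
    (f := fun (n : ℕ) t => x (((⌊((n : ℝ≥0) + 1) * t⌋₊ : ℝ≥0) + 1) / (n + 1))) (fun n => ?_)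
    (tendsto_pi_nhds.2 fun t => (hx t).1.tendsto.comp (tendsto_floor_add_one_div t))
  have h1 : Measurable fun t : ℝ≥0 => ⌊((n : ℝ≥0) + 1) * t⌋₊ :=
    Nat.measurable_floor.comp (measurable_id.const_mul _)
  exact (measurable_from_nat (f := fun m : ℕ => x (((m : ℝ≥0) + 1) / (n + 1)))).comp h1

/-! ### The Skorokhod topology -/

theorem hasBasis_uniformity : (uniformity CadlagPath).HasBasis
    (fun p : ℝ≥0 × ℝ≥0 => 0 < p.2) (fun p => skorokhodEntourage p.1 p.2) := by
  refine ⟨fun s => ?_⟩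
  change s ∈ skorokhodBasis.filter ↔ _
  rw [FilterBasis.mem_filter_iff]
  constructor
  · rintro ⟨_, ⟨T, δ, hδ, rfl⟩, hs⟩
    exact ⟨(T, δ), hδ, hs⟩
  · rintro ⟨⟨T, δ⟩, hδ, hs⟩
    exact ⟨_, ⟨T, δ, hδ, rfl⟩, hs⟩

theorem hasBasis_nhds_cadlagPath (x : CadlagPath) : (𝓝 x).HasBasis
    (fun p : ℝ≥0 × ℝ≥0 => 0 < p.2) (fun p => {y | (x, y) ∈ skorokhodEntourage p.1 p.2}) :=
  nhds_basis_uniformity' hasBasis_uniformity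

/-- This makes the path space pseudometrizable, so that pointwise limits of measurable random paths
are measurable. -/
instance : (uniformity CadlagPath).IsCountablyGenerated := by
  refine HasCountableBasis.isCountablyGenerated (ι := ℕ) (p := fun _ => True)
    (s := fun n => skorokhodEntourage n (1 / (n + 1))) ⟨?_, Set.to_countable _⟩
  refine hasBasis_uniformity.to_hasBasis (fun ⟨T, δ⟩ hδ => ?_) fun n _ =>
    ⟨(n, 1 / (n + 1)), by positivity, le_rfl⟩
  obtain ⟨n, hn⟩ := exists_nat_one_div_lt (K := ℝ≥0) hδ
  obtain ⟨m, hm⟩ := exists_nat_ge T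
  refine ⟨max n m, trivial, skorokhodEntourage_mono (hm.trans ?_) (le_trans ?_ hn.le)⟩
  · exact_mod_cast le_max_right n m
  · gcongr
    exact_mod_cast le_max_left n m

/-- Locally uniform closeness implies closeness in the Skorokhod topology. -/
theorem mem_skorokhodEntourage_of_dist_le {x y : CadlagPath} {T δ : ℝ≥0}
    (h : ∀ t ≤ T, dist (x t) (y t) ≤ δ) : (x, y) ∈ skorokhodEntourage T δ :=
  ⟨OrderIso.refl _, fun t ht => ⟨by simp, h t ht⟩⟩

/-- The step function with value `a k` on `[k / (n + 1), (k + 1) / (n + 1))`. -/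
noncomputable def stepPath (n : ℕ) (a : ℕ → ℝ) : CadlagPath where
  toFun t := a ⌊((n : ℝ≥0) + 1) * t⌋₊
  isCadlag := by
    have hn : (0 : ℝ≥0) < (n : ℝ≥0) + 1 := by positivity
    refine fun t => ⟨?_, ?_⟩
    · have ht : t < ((⌊((n : ℝ≥0) + 1) * t⌋₊ : ℝ≥0) + 1) / (n + 1) := by
        rw [lt_div_iff₀ hn, mul_comm]
        exact Nat.lt_floor_add_one _
      refine tendsto_const_nhds.congr' ?_
      filter_upwards [Ico_mem_nhdsGE ht] with s hs
      congr 1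
      symm
      rw [Nat.floor_eq_iff zero_le]
      refine ⟨(Nat.floor_le zero_le).trans (by gcongr; exact hs.1), ?_⟩
      have := hs.2
      rwa [lt_div_iff₀ hn, mul_comm] at this
    · rcases eq_zero_or_pos t with rfl | ht
      · exact ⟨0, by rw [show Set.Iio (0 : ℝ≥0) = ∅ by ext; simp]; simp⟩
      · set k := ⌈((n : ℝ≥0) + 1) * t⌉₊ - 1
        have hk1 : k + 1 = ⌈((n : ℝ≥0) + 1) * t⌉₊ :=
          Nat.sub_add_cancel (Nat.one_le_iff_ne_zero.2 (Nat.ceil_pos.2 (by positivity)).ne')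
        have hk : (k : ℝ≥0) / (n + 1) < t := by
          rw [div_lt_iff₀ hn, mul_comm]
          exact Nat.lt_ceil.1 (by omega)
        refine ⟨a k, tendsto_const_nhds.congr' ?_⟩
        filter_upwards [Ioo_mem_nhdsLT hk] with s hs
        congr 1
        symm
        rw [Nat.floor_eq_iff zero_le]
        have h1 := hs.1
        rw [div_lt_iff₀ hn, mul_comm] at h1
        refine ⟨h1.le, lt_of_lt_of_le (b := ((n : ℝ≥0) + 1) * t) (by gcongr; exact hs.2) ?_⟩
        exact_mod_cast (Nat.le_ceil (((n : ℝ≥0) + 1) * t)).trans_eq (by rw [← hk1])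

/-- On [0, T] only finitely many coefficients matter. -/
theorem continuous_stepPath (n : ℕ) : Continuous (stepPath n) := by
  refine continuous_iff_continuousAt.2 fun a => ?_
  refine (hasBasis_nhds_cadlagPath _).tendsto_right_iff.2 fun ⟨T, δ⟩ hδ => ?_
  have h : ∀ᶠ b in 𝓝 a, ∀ k ∈ Finset.range (⌊((n : ℝ≥0) + 1) * T⌋₊ + 1), dist (a k) (b k) < δ := by
    rw [Filter.eventually_all_finset]
    intro k _
    have : Tendsto (fun b : ℕ → ℝ => dist (a k) (b k)) (𝓝 a) (𝓝 (dist (a k) (a k))) :=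
      (continuous_const.dist (continuous_apply k)).tendsto a
    rw [dist_self] at this
    exact this.eventually (eventually_lt_nhds (by exact_mod_cast hδ))
  filter_upwards [h] with b hb
  refine mem_skorokhodEntourage_of_dist_le fun t ht => (hb _ ?_).le
  rw [Finset.mem_range, Nat.lt_succ_iff]
  exact Nat.floor_mono (by gcongr)

/-- An order isomorphism can be changed after time `a` so as to be affine there and to take a
prescribed value at `b > a`. -/
theorem exists_orderIso_affine (e : ℝ≥0 ≃o ℝ≥0) {a b c : ℝ≥0} (hab : a < b) (hc : e a < c) :
    ∃ e' : ℝ≥0 ≃o ℝ≥0, (∀ t ≤ a, e' t = e t) ∧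
      ∀ t, a ≤ t → (e' t : ℝ) = e a + (c - e a) / (b - a) * (t - a) := by
  set k : ℝ≥0 := (c - e a) / (b - a) with hk
  have hk0 : 0 < k := div_pos (tsub_pos_of_lt hc) (tsub_pos_of_lt hab)
  set g : ℝ≥0 → ℝ≥0 := fun t => if t ≤ a then e t else e a + k * (t - a) with hg
  have hg1 : ∀ t ≤ a, g t = e t := fun t ht => if_pos ht
  have hg2 : ∀ t, a ≤ t → g t = e a + k * (t - a) := by
    intro t ht
    rcases ht.lt_or_eq with h | rfl
    · exact if_neg (not_le.2 h)
    · simp [hg]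
  have hmono : StrictMono g := by
    intro s t hst
    rcases le_total t a with h | h
    · rw [hg1 t h, hg1 s (hst.le.trans h)]
      exact e.strictMono hst
    · rw [hg2 t h]
      rcases lt_or_ge s a with h' | h'
      · rw [hg1 s h'.le]
        exact (e.strictMono h').trans_le le_self_add
      · rw [hg2 s h']
        gcongr
        exact tsub_lt_tsub_right_of_le h' hst
  have hsurj : Function.Surjective g := by
    intro y
    rcases le_total y (e a) with h | h
    · exact ⟨e.symm y, by rw [hg1 _ (by rwa [OrderIso.symm_apply_le]), e.apply_symm_apply]⟩
    · refine ⟨a + (y - e a) / k, ?_⟩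
      rw [hg2 _ le_self_add, add_tsub_cancel_left, mul_div_cancel₀ _ hk0.ne',
        add_tsub_cancel_of_le h]
  refine ⟨StrictMono.orderIsoOfSurjective g hmono hsurj, fun t ht => hg1 t ht, fun t ht => ?_⟩
  change ((g t : ℝ≥0) : ℝ) = _
  rw [hg2 t ht, hk]
  push_cast [NNReal.coe_sub ht, NNReal.coe_sub hc.le, NNReal.coe_sub hab.le]
  rfl

/-- Discretizations of a càdlàg path converge to it in the Skorokhod topology. -/
theorem tendsto_stepPath (x : CadlagPath) :
    Tendsto (fun n : ℕ => stepPath n fun k => x ((k : ℝ≥0) / (n + 1))) atTop (𝓝 x) := by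
  refine (hasBasis_nhds_cadlagPath _).tendsto_right_iff.2 ?_
  rintro ⟨T, δ⟩ hδ
  have hδ' : (0 : ℝ) < δ := by exact_mod_cast hδ
  -- The induction carries l T = the first grid point at or after T. A new piece [a, b) is mapped
  -- affinely onto the interval between the grid points of a and b; the grid point sampled for t in
  -- [a, b) then lies in [a, b) itself, where x oscillates by at most δ.
  have key := x.isCadlag.induction hδ' (p := fun T => ∀ᶠ n : ℕ in atTop, ∃ l : ℝ≥0 ≃o ℝ≥0,
    l T = (⌈((n : ℝ≥0) + 1) * T⌉₊ : ℝ≥0) / (n + 1) ∧ ∀ t < T, dist (l t) t ≤ δ ∧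
      dist (x t) (x ((⌊((n : ℝ≥0) + 1) * l t⌋₊ : ℝ≥0) / (n + 1))) ≤ δ) ?_ ?_ (T + 1)
  · filter_upwards [key] with n ⟨l, _, hl⟩
    exact ⟨l, fun t ht => hl t (ht.trans_lt (lt_add_one T))⟩
  · exact Eventually.of_forall fun n => ⟨OrderIso.refl _, by simp, fun t ht =>
      absurd ht (not_lt.2 zero_le)⟩
  · intro a b hab ha hosc
    have hlim := tendsto_one_div_add_atTop_nhds_zero_nat (𝕜 := ℝ)
    have hab' : (a : ℝ) < b := by exact_mod_cast hab
    filter_upwards [ha, hlim.eventually (eventually_lt_nhds hδ'),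
      hlim.eventually (eventually_lt_nhds (sub_pos.2 hab'))] with n ⟨l, hla, hl⟩ hnδ hnab
    rw [show (n : ℝ) + 1 = (((n : ℝ≥0) + 1 : ℝ≥0) : ℝ) by push_cast; rfl] at hnδ hnab
    have hn' : (0 : ℝ≥0) < (n : ℝ≥0) + 1 := by positivity
    generalize (n : ℝ≥0) + 1 = N at hla hl hnδ hnab hn' ⊢
    have hn : (0 : ℝ) < N := by exact_mod_cast hn'
    rw [div_lt_iff₀ hn] at hnδ hnab
    have ha0 : N * a ≤ (⌈N * a⌉₊ : ℝ≥0) := Nat.le_ceil _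
    have ha1 : (N : ℝ) * a ≤ (⌈N * a⌉₊ : ℝ) := by exact_mod_cast ha0
    have ha2 : (⌈N * a⌉₊ : ℝ) < N * a + 1 := by
      exact_mod_cast Nat.ceil_lt_add_one (zero_le (a := N * a))
    have hb1 : (N : ℝ) * b ≤ (⌈N * b⌉₊ : ℝ) := by exact_mod_cast Nat.le_ceil (N * b)
    have hb3 : ∀ m : ℕ, m < ⌈N * b⌉₊ → (m : ℝ≥0) < N * b := fun m => Nat.lt_ceil.1
    generalize ⌈N * a⌉₊ = ca at hla ha0 ha1 ha2
    generalize ⌈N * b⌉₊ = cb at hb1 hb3 ⊢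
    have hb2 : (cb : ℝ) < N * b + 1 := by
      rcases cb with _ | m
      · simp only [Nat.cast_zero]
        positivity
      · have : (m : ℝ) < N * b := by exact_mod_cast hb3 m (Nat.lt_succ_self m)
        push_cast
        linarith
    have hcab : (ca : ℝ) < cb := by nlinarith
    have hcab' : l a < (cb : ℝ≥0) / N := by
      rw [hla]
      gcongr
      exact_mod_cast hcab
    obtain ⟨l', hl'1, hl'2⟩ := exists_orderIso_affine l hab hcab'
    have hlaR : (l a : ℝ) = ca / N := by rw [hla]; push_cast; rfl
    have hcR : (((cb : ℝ≥0) / N : ℝ≥0) : ℝ) = cb / N := by push_cast; rfl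
    have hba : (0 : ℝ) < b - a := by linarith
    refine ⟨l', ?_, fun t ht => ?_⟩
    · rw [← NNReal.coe_inj, hl'2 b hab.le, div_mul_cancel₀ _ hba.ne', add_sub_cancel]
    rcases lt_or_ge t a with hta | hta
    · rw [hl'1 t hta.le]
      exact hl t hta
    have hta' : (a : ℝ) ≤ t := by exact_mod_cast hta
    have htb' : (t : ℝ) < b := by exact_mod_cast ht
    set q : ℝ := ((t : ℝ) - a) / (b - a) with hq
    have hq0 : 0 ≤ q := div_nonneg (by linarith) hba.le
    have hq1 : q < 1 := by rw [hq, div_lt_one hba]; linarith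
    have hteq : (t : ℝ) = a + q * (b - a) := by rw [hq, div_mul_cancel₀ _ hba.ne']; ring
    have hlt : (N : ℝ) * (l' t : ℝ) = ca + (cb - ca) * q := by
      rw [hl'2 t hta, hlaR, hcR, hq]
      field_simp
    constructor
    · rw [NNReal.dist_eq]
      -- The difference N l'(t) - N t is a convex combination of the rounding errors ca - N a and cb
      -- - N b, both in [0, 1), and 1 < N δ.
      have h1 : N * |(l' t : ℝ) - t| ≤ N * δ := by
        rw [← abs_of_pos hn, ← abs_mul, abs_of_pos hn, mul_sub, hlt, hteq, abs_le]
        constructor <;> nlinarith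
      exact le_of_mul_le_mul_left h1 hn
    · have h1 : ca ≤ ⌊N * l' t⌋₊ := by
        refine Nat.le_floor ?_
        have : (ca : ℝ) ≤ (N : ℝ) * (l' t : ℝ) := by rw [hlt]; nlinarith
        exact_mod_cast this
      have h2 : ⌊N * l' t⌋₊ < cb := by
        rw [Nat.floor_lt zero_le]
        have : (N : ℝ) * (l' t : ℝ) < cb := by rw [hlt]; nlinarith
        exact_mod_cast this
      refine hosc _ _ hta ht ?_ ?_
      · rw [le_div_iff₀ hn', mul_comm]
        exact ha0.trans (by exact_mod_cast h1)
      · rw [div_lt_iff₀ hn', mul_comm b]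
        exact hb3 _ h2

/-- A random path is measurable as soon as its values at fixed times are. -/
theorem measurable_of_measurable_eval {Ω : Type*} [MeasurableSpace Ω] {X : Ω → CadlagPath}
    (hX : ∀ t, Measurable fun ω => X ω t) : Measurable X := by
  refine measurable_of_tendsto_metrizable
    (f := fun (n : ℕ) ω => stepPath n fun k => X ω ((k : ℝ≥0) / (n + 1))) (fun n => ?_)
    (tendsto_pi_nhds.2 fun ω => tendsto_stepPath (X ω))
  exact (continuous_stepPath n).measurable.comp (measurable_pi_lambda _ fun k => hX _)

/-- The identity map is a random path for the σ-algebra generated by the evaluations, so the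
preceding criterion applies to it. -/
theorem borel_le_comap_toFun :
    borel CadlagPath ≤ MeasurableSpace.comap CadlagPath.toFun inferInstance := by
  have h := @measurable_of_measurable_eval CadlagPath
    (MeasurableSpace.comap CadlagPath.toFun inferInstance) id fun t =>
      (measurable_pi_apply t).comp (comap_measurable _)
  intro s hs
  exact h hs

/-- Two random paths with the same finite-dimensional distributions have the same law. -/
theorem map_eq_of_identDistrib {Ω Ω' : Type*} [MeasurableSpace Ω] [MeasurableSpace Ω']
    {P : Measure Ω} {P' : Measure Ω'} {X : Ω → CadlagPath} {X' : Ω' → CadlagPath}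
    (hX : ∀ t, Measurable fun ω => X ω t) (hX' : ∀ t, Measurable fun ω => X' ω t)
    (h : IdentDistrib (fun ω (t : ℝ≥0) => X ω t) (fun ω (t : ℝ≥0) => X' ω t) P P') :
    P.map X = P'.map X' := by
  ext s hs
  obtain ⟨S, hS, rfl⟩ := borel_le_comap_toFun s hs
  rw [Measure.map_apply (measurable_of_measurable_eval hX) hs,
    Measure.map_apply (measurable_of_measurable_eval hX') hs]
  exact h.measure_mem_eq hS

end SmallNoise

namespace SmallNoise

/-! ### Solutions of the equation as paths with a power drift -/

theorem measurable_drift (cp cm α : ℝ) : Measurable (drift cp cm α) := by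
  refine Measurable.mul ?_ ((measurable_id.abs).pow_const α)
  exact Measurable.ite measurableSet_Ici measurable_const measurable_const

theorem enorm_drift_le (cp cm α x : ℝ) :
    ‖drift cp cm α x‖ₑ ≤ (‖cp‖ₑ + ‖cm‖ₑ) * ‖x‖ₑ ^ α := by
  rw [drift, enorm_mul]
  gcongr
  · split_ifs
    · exact le_self_add
    · rw [enorm_neg]; exact le_add_self
  · rcases eq_or_ne x 0 with rfl | hx
    · rcases lt_trichotomy α 0 with h | rfl | h
      · simp [ENNReal.zero_rpow_of_neg h]
      · simp
      · simp [Real.zero_rpow h.ne', h]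
    · have h : 0 < |x| := abs_pos.2 hx
      rw [Real.enorm_eq_ofReal (by positivity), ← ENNReal.ofReal_rpow_of_pos h, ← Real.enorm_abs x,
        Real.enorm_eq_ofReal (abs_nonneg x)]

theorem drift_of_pos {cp cm α x : ℝ} (hx : 0 < x) : drift cp cm α x = cp * x ^ α := by
  rw [drift, if_pos hx.le, abs_of_pos hx]

theorem drift_of_neg {cp cm α x : ℝ} (hx : x < 0) : drift cp cm α x = -(cm * (-x) ^ α) := by
  rw [drift, if_neg (not_le.2 hx), abs_of_neg hx, neg_mul]

section

variable {cp cm α : ℝ} {x : CadlagPath} {g : ℝ≥0 → ℝ}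

theorem SolvesEquation.intervalIntegrable (h : SolvesEquation cp cm α x g) (s t : ℝ) :
    IntervalIntegrable (fun s => drift cp cm α (x s.toNNReal)) volume s t := by
  have hm : Measurable fun s : ℝ => x s.toNNReal := x.isCadlag.measurable.comp measurable_real_toNNReal
  have h0 : ∀ t, IntervalIntegrable (fun s => drift cp cm α (x s.toNNReal)) volume 0 t := by
    intro t
    rcases le_total 0 t with ht | ht
    · rw [intervalIntegrable_iff_integrableOn_Ioc_of_le ht]
      refine ⟨((measurable_drift _ _ _).comp hm).aestronglyMeasurable, ?_⟩
      rw [hasFiniteIntegral_iff_enorm]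
      refine (lintegral_mono fun s => enorm_drift_le cp cm α _).trans_lt ?_
      rw [lintegral_const_mul _ (hm.enorm.pow_const α)]
      have := (h t.toNNReal).1
      rw [Real.coe_toNNReal t ht] at this
      exact ENNReal.mul_lt_top (by simp) this.lt_top
    -- At negative times `Real.toNNReal` is 0, so the integrand is constant.
    · refine (intervalIntegrable_const (c := drift cp cm α (x 0))).congr ?_
      intro s hs
      rw [Set.uIoc_of_ge ht] at hs
      simp only [Real.toNNReal_of_nonpos hs.2]
  exact (h0 s).symm.trans (h0 t)

theorem SolvesEquation.hasPowerDrift (h : SolvesEquation cp cm α x g) :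
    HasPowerDrift cp α (fun t => x t.toNNReal) (fun t => drift cp cm α (x t.toNNReal))
      (fun t => g t.toNNReal) where
  integrable := h.intervalIntegrable
  eq t ht := by
    have := (h t.toNNReal).2
    rwa [Real.coe_toNNReal t ht] at this
  drift t _ hx := drift_of_pos hx

/-- Reflection x ↦ -x exchanges the roles of c₊ and c₋, so results on the positive side also cover
the negative one. -/
theorem SolvesEquation.hasPowerDrift_neg (h : SolvesEquation cp cm α x g) :
    HasPowerDrift cm α (-fun t => x t.toNNReal) (-fun t => drift cp cm α (x t.toNNReal))
      (-fun t => g t.toNNReal) where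
  integrable s t := (h.intervalIntegrable s t).neg
  eq t ht := by
    have := h.hasPowerDrift.eq t ht
    simp only [Pi.neg_apply, intervalIntegral.integral_neg]
    rw [this]
    ring
  drift t _ hx := by
    simp only [Pi.neg_apply] at hx ⊢
    rw [drift_of_neg (neg_pos.1 hx), neg_neg]

end

/-! ### The extremal solutions of the equation without noise -/

theorem mul_rpow_eq {c α : ℝ} (hc : 0 < c) (hα : α < 1) :
    c * ((c * (1 - α)) ^ (1 / (1 - α))) ^ α = (c * (1 - α)) ^ (1 / (1 - α)) * (1 / (1 - α)) := by
  have h1 : 0 < 1 - α := by linarith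
  have h2 : 0 < c * (1 - α) := by positivity
  rw [← Real.rpow_mul h2.le, one_div_one_sub_mul hα, Real.rpow_sub_one h2.ne']
  field_simp

/-- Separation of variables: after the last zero z, A ^ (1 - α) has constant derivative (1 - α) c,
so it equals (1 - α) c (t - z), which is largest for z = 0. -/
theorem HasPowerDrift.le_of_no_noise {c α : ℝ} {x f : ℝ → ℝ} (h : HasPowerDrift c α x f 0)
    (hc : 0 < c) (hα : α < 1) {t : ℝ} (ht : 0 ≤ t) :
    x t ≤ (c * (1 - α)) ^ (1 / (1 - α)) * t ^ (1 / (1 - α)) := by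
  have h1 : 0 < 1 - α := by linarith
  set A : ℝ → ℝ := fun t => ∫ u in (0 : ℝ)..t, f u with hA
  have hxA : ∀ u, 0 ≤ u → x u = A u := fun u hu => by simpa using h.eq u hu
  have hAc : Continuous A := h.continuous
  rw [hxA t ht]
  rcases le_or_gt (A t) 0 with hneg | hpos
  · exact hneg.trans (by positivity)
  obtain ⟨z, hz0, hzt, hz, hzpos⟩ := exists_last_zero hAc ht (by simp [hA]) hpos
  have hderiv : ∀ u ∈ Set.Ioo z t, HasDerivAt (fun v => A v ^ (1 - α)) ((1 - α) * c) u := by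
    intro u hu
    have hAu := hzpos u hu.1 hu.2.le
    have hev : (fun v => c * A v ^ α) =ᶠ[𝓝 u] f := by
      filter_upwards [Ioo_mem_nhds hu.1 hu.2] with v hv
      have hv0 : 0 ≤ v := hz0.trans hv.1.le
      have hAv := hzpos v hv.1 hv.2.le
      rw [h.drift v hv0 (by rwa [hxA v hv0]), hxA v hv0]
    have hfc : ContinuousAt f u := by
      refine ContinuousAt.congr ?_ hev
      exact continuousAt_const.mul (hAc.continuousAt.rpow_const (Or.inl hAu.ne'))
    have hmeas : StronglyMeasurableAtFilter f (𝓝 u) := by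
      refine ⟨Set.Ioc z t, Filter.mem_of_superset (Ioo_mem_nhds hu.1 hu.2)
        Set.Ioo_subset_Ioc_self, ?_⟩
      exact (h.integrable z t).aestronglyMeasurable
    have h2 := (intervalIntegral.integral_hasDerivAt_right (h.integrable 0 u) hmeas hfc).rpow_const
      (p := 1 - α) (Or.inl hAu.ne')
    convert h2 using 1
    rw [← hev.self_of_nhds]
    change (1 - α) * c = c * A u ^ α * (1 - α) * A u ^ (1 - α - 1)
    have h3 : A u ^ α * A u ^ (1 - α - 1) = 1 := by
      rw [← Real.rpow_add hAu]; simp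
    linear_combination (-(1 - α) * c) * h3
  obtain ⟨w, -, hw⟩ := exists_hasDerivAt_eq_slope (fun v => A v ^ (1 - α)) _ hzt
    (hAc.rpow_const fun _ => Or.inr h1.le).continuousOn hderiv
  rw [eq_div_iff (by linarith), hz, Real.zero_rpow h1.ne', sub_zero] at hw
  have h4 : A t = (A t ^ (1 - α)) ^ (1 / (1 - α)) := by
    rw [← Real.rpow_mul hpos.le, mul_one_div_cancel h1.ne', Real.rpow_one]
  rw [h4, ← hw, ← Real.mul_rpow (by positivity) ht]
  refine Real.rpow_le_rpow (mul_nonneg (by positivity) (by linarith)) ?_ (by positivity)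
  rw [mul_comm c]
  gcongr
  linarith

theorem solvesEquation_of_eq_rpow {cp cm α c q : ℝ} (hc : 0 < c) (hα : α < 1) (hq : |q| = 1)
    (hd : ∀ y, 0 < y → drift cp cm α (q * y) = q * (c * y ^ α)) {x : CadlagPath}
    (hx : ∀ t : ℝ≥0, x t = q * ((c * (1 - α)) ^ (1 / (1 - α)) * (t : ℝ) ^ (1 / (1 - α)))) :
    SolvesEquation cp cm α x 0 := by
  have h1 : 0 < 1 - α := by linarith
  set C := (c * (1 - α)) ^ (1 / (1 - α)) with hC
  have hC0 : 0 < C := by positivity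
  set γ := 1 / (1 - α) with hγdef
  have hγ : 0 < γ := one_div_pos.2 h1
  have hpow : ∀ s : ℝ, 0 < s → c * (C * s ^ γ) ^ α = C * γ * (s + 0) ^ (γ - 1) := by
    intro s hs
    rw [mul_mul_rpow_rpow hα hC0.le hs.le, ← mul_assoc, hC, mul_rpow_eq hc hα, add_zero]
  intro t
  have ht : (0 : ℝ) ≤ t := t.2
  constructor
  -- The constant C / c turns the integrand into (C s ^ γ) ^ α; it is integrable at 0 since γ - 1 >
  -- -1, even for negative α.
  · have hint := (integral_add_rpow (s := 0) (t := t) (r := 0) (m := C / c) hγ).1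
    rw [intervalIntegrable_iff_integrableOn_Ioc_of_le ht] at hint
    refine ne_of_lt (lt_of_eq_of_lt (setLIntegral_congr_fun measurableSet_Ioc fun s hs => ?_)
      (hasFiniteIntegral_iff_enorm.1 hint.2))
    have hs : 0 < s := hs.1
    have hy : 0 < C * s ^ γ := by positivity
    have h2 : C / c * γ * (s + 0) ^ (γ - 1) = (C * s ^ γ) ^ α := by
      have := hpow s hs
      field_simp
      linarith
    rw [h2, hx, Real.coe_toNNReal s hs.le, ← Real.enorm_abs, abs_mul, hq, one_mul, abs_of_pos hy,
      Real.enorm_eq_ofReal hy.le, Real.enorm_eq_ofReal (by positivity),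
      ENNReal.ofReal_rpow_of_pos hy]
  · have h3 : ∫ s in (0 : ℝ)..t, drift cp cm α (x s.toNNReal) =
        ∫ s in (0 : ℝ)..t, q * (C * γ * (s + 0) ^ (γ - 1)) := by
      refine intervalIntegral.integral_congr_ae (Eventually.of_forall fun s hs => ?_)
      rw [Set.uIoc_of_le ht] at hs
      have hs0 : 0 < s := hs.1
      rw [hx, Real.coe_toNNReal s hs0.le, hd _ (by positivity), hpow s hs0]
    rw [h3, intervalIntegral.integral_const_mul, (integral_add_rpow hγ).2, hx]
    simp [Real.zero_rpow hγ.ne']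

theorem powerPath_apply {α : ℝ} (hα : α < 1) (k : ℝ) (t : ℝ≥0) :
    powerPath α hα k t = (1 - α) ^ (1 / (1 - α)) * k * (t : ℝ) ^ (1 / (1 - α)) := by
  change ((1 - α) * (t : ℝ)) ^ (1 / (1 - α)) * k = _
  rw [Real.mul_rpow (by linarith) t.coe_nonneg]
  ring

section

variable {c α : ℝ}

theorem maxPath_apply (hc : 0 < c) (hα : α < 1) (t : ℝ≥0) :
    maxPath c α hα t = (c * (1 - α)) ^ (1 / (1 - α)) * (t : ℝ) ^ (1 / (1 - α)) := by
  rw [maxPath, powerPath_apply, Real.mul_rpow hc.le (by linarith)]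
  ring

theorem minPath_apply (hc : 0 < c) (hα : α < 1) (t : ℝ≥0) :
    minPath c α hα t = -((c * (1 - α)) ^ (1 / (1 - α)) * (t : ℝ) ^ (1 / (1 - α))) := by
  rw [minPath, powerPath_apply, Real.mul_rpow hc.le (by linarith)]
  ring

end

theorem extremal_solutions {cp cm α : ℝ} (hcp : 0 < cp) (hcm : 0 < cm) (hα : α < 1) :
    SolvesEquation cp cm α (maxPath cp α hα) 0 ∧ SolvesEquation cp cm α (minPath cm α hα) 0 ∧
      ∀ y : CadlagPath, SolvesEquation cp cm α y 0 →
        ∀ t, minPath cm α hα t ≤ y t ∧ y t ≤ maxPath cp α hα t := by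
  refine ⟨solvesEquation_of_eq_rpow hcp hα (q := 1) (by simp) (fun y hy => ?_) fun t => ?_,
    solvesEquation_of_eq_rpow hcm hα (q := -1) (by simp) (fun y hy => ?_) fun t => ?_,
    fun y hy t => ⟨?_, ?_⟩⟩
  · rw [one_mul, one_mul, drift_of_pos hy]
  · rw [maxPath_apply hcp, one_mul]
  · rw [neg_one_mul, neg_one_mul, drift_of_neg (neg_neg_of_pos hy), neg_neg]
  · rw [minPath_apply hcm, neg_one_mul]
  · have h := hy.hasPowerDrift_neg
    rw [show (-fun t : ℝ => (0 : ℝ≥0 → ℝ) t.toNNReal) = 0 by ext; simp] at h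
    have h' := h.le_of_no_noise hcm hα t.2
    rw [minPath_apply hcm]
    change -y (t : ℝ).toNNReal ≤ _ at h'
    rw [Real.toNNReal_coe] at h'
    exact neg_le.1 h'
  · have h' := HasPowerDrift.le_of_no_noise hy.hasPowerDrift hcp hα t.2
    rw [maxPath_apply hcp]
    change y (t : ℝ).toNNReal ≤ _ at h'
    rwa [Real.toNNReal_coe] at h'

end SmallNoise

namespace SmallNoise

/-! ### Rescaled paths -/

/-- The path `t ↦ r * x (a * t)`. -/
noncomputable def scalePath (r : ℝ) (a : ℝ≥0) (x : CadlagPath) : CadlagPath where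
  toFun t := r * x (a * t)
  isCadlag t := by
    constructor
    · refine continuousWithinAt_const.mul ((x.isCadlag (a * t)).1.comp
        (continuous_const_mul a).continuousWithinAt fun s hs => ?_)
      exact mul_le_mul_right hs a
    · rcases eq_zero_or_pos a with rfl | ha
      · exact ⟨r * x 0, by simpa using tendsto_const_nhds⟩
      · obtain ⟨l, hl⟩ := (x.isCadlag (a * t)).2
        refine ⟨r * l, (hl.comp (tendsto_nhdsWithin_iff.2 ⟨?_, ?_⟩)).const_mul r⟩
        · exact ((continuous_const_mul a).tendsto t).mono_left nhdsWithin_le_nhds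
        · filter_upwards [self_mem_nhdsWithin] with s hs
          exact mul_lt_mul_of_pos_left hs ha

theorem scalePath_apply (r : ℝ) (a : ℝ≥0) (x : CadlagPath) (t : ℝ≥0) :
    scalePath r a x t = r * x (a * t) := rfl

/-- The time factor is l ^ (-1 / γ), for which t ^ γ is invariant. The convergence is locally
uniform, so no time change is needed. -/
theorem tendsto_scalePath {α : ℝ} (hα : α < 1) {x : CadlagPath} {k : ℝ}
    (hx : Tendsto (fun t : ℝ => x t.toNNReal / t ^ (1 / (1 - α))) atTop
      (𝓝 ((1 - α) ^ (1 / (1 - α)) * k))) :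
    Tendsto (fun l : ℝ => scalePath l (l ^ (-(1 - α))).toNNReal x) (𝓝[>] 0)
      (𝓝 (powerPath α hα k)) := by
  have hγ : 0 < 1 / (1 - α) := one_div_pos.2 (by linarith)
  refine (hasBasis_nhds_cadlagPath _).tendsto_right_iff.2 fun ⟨T, δ⟩ hδ => ?_
  have hbdd : ∀ T : ℝ, ∃ M, ∀ t : ℝ, 0 ≤ t → t ≤ T → |x t.toNNReal| ≤ M := by
    intro T
    obtain ⟨M, hM⟩ := x.isCadlag.exists_bound T.toNNReal
    exact ⟨M, fun t _ ht => hM _ (Real.toNNReal_le_toNNReal ht)⟩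
  filter_upwards [eventually_rescale_le hγ hbdd hx T (NNReal.coe_pos.2 hδ), self_mem_nhdsWithin]
    with l hl hl0
  rw [Set.mem_Ioi] at hl0
  refine mem_skorokhodEntourage_of_dist_le fun t ht => ?_
  have h := hl t t.coe_nonneg (by exact_mod_cast ht)
  rw [one_div_one_div, Real.toNNReal_mul (by positivity), Real.toNNReal_coe] at h
  rwa [dist_comm, Real.dist_eq, powerPath_apply, scalePath_apply]

/-! ### Rescaled weak solutions -/

theorem drift_mul {cp cm α r x : ℝ} (hr : 0 < r) :
    drift cp cm α (r * x) = r ^ α * drift cp cm α x := by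
  simp only [drift, mul_nonneg_iff_of_pos_left hr]
  rw [abs_mul, abs_of_pos hr, Real.mul_rpow hr.le (abs_nonneg x)]
  ring

theorem lintegral_Ioc_comp_mul {f : ℝ → ℝ≥0∞} (hf : Measurable f) {a : ℝ} (ha : 0 < a) (t : ℝ) :
    ∫⁻ s in Set.Ioc 0 t, f (a * s) = ENNReal.ofReal |a⁻¹| * ∫⁻ s in Set.Ioc 0 (a * t), f s := by
  rw [← lintegral_indicator measurableSet_Ioc, ← lintegral_indicator measurableSet_Ioc,
    ← smul_eq_mul, ← lintegral_smul_measure, ← Real.map_volume_mul_left ha.ne',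
    lintegral_map (hf.indicator measurableSet_Ioc) (measurable_const_mul a)]
  refine lintegral_congr fun s => ?_
  simp only [Set.indicator, Set.mem_Ioc, mul_pos_iff_of_pos_left ha, mul_le_mul_iff_right₀ ha]

/-- Homogeneity of the drift contributes l ^ (-α) and the substitution in time a⁻¹ = l ^ (-(1 - α));
together they give the factor l⁻¹ of the path. -/
theorem SolvesEquation.scale {cp cm α l : ℝ} {x : CadlagPath} {g : ℝ≥0 → ℝ}
    (h : SolvesEquation cp cm α x g) (hl : 0 < l) {a : ℝ≥0} (ha : (a : ℝ) = l ^ (1 - α)) :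
    SolvesEquation cp cm α (scalePath l⁻¹ a x) (fun t => l⁻¹ * g (a * t)) := by
  have ha0 : (0 : ℝ) < a := by rw [ha]; positivity
  have hto : ∀ s : ℝ, a * s.toNNReal = (a * s : ℝ).toNNReal := by
    intro s
    rw [Real.toNNReal_mul a.coe_nonneg, Real.toNNReal_coe]
  have hm : Measurable fun s : ℝ => ‖x s.toNNReal‖ₑ ^ α :=
    (x.isCadlag.measurable.comp measurable_real_toNNReal).enorm.pow_const α
  intro t
  obtain ⟨h1, h2⟩ := h (a * t)
  rw [NNReal.coe_mul] at h1 h2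
  constructor
  · have h3 : ∀ s : ℝ, ‖scalePath l⁻¹ a x s.toNNReal‖ₑ ^ α =
        ‖l⁻¹‖ₑ ^ α * ‖x (a * s : ℝ).toNNReal‖ₑ ^ α := by
      intro s
      rw [scalePath_apply, hto, enorm_mul, ENNReal.mul_rpow_of_ne_top enorm_ne_top enorm_ne_top]
    simp only [h3]
    have hma : Measurable fun s : ℝ => ‖x (a * s : ℝ).toNNReal‖ₑ ^ α :=
      hm.comp (measurable_const_mul (a : ℝ))
    rw [lintegral_const_mul _ hma, lintegral_Ioc_comp_mul hm ha0]
    refine ENNReal.mul_ne_top (ENNReal.rpow_ne_top_of_ne_zero ?_ enorm_ne_top)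
      (ENNReal.mul_ne_top ENNReal.ofReal_ne_top h1)
    simpa using hl.ne'
  · have h3 : ∀ s : ℝ, drift cp cm α (scalePath l⁻¹ a x s.toNNReal) =
        l⁻¹ ^ α * drift cp cm α (x (a * s : ℝ).toNNReal) := by
      intro s
      rw [scalePath_apply, hto, drift_mul (inv_pos.2 hl)]
    simp only [h3]
    rw [intervalIntegral.integral_const_mul,
      intervalIntegral.integral_comp_mul_left (fun s => drift cp cm α (x s.toNNReal)) ha0.ne',
      scalePath_apply, h2, mul_zero, smul_eq_mul, ← mul_assoc, ha, Real.inv_rpow hl.le,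
      ← mul_inv, ← Real.rpow_add hl, add_sub_cancel, Real.rpow_one]
    ring

theorem comap_const_mul {Ω : Type*} {c : ℝ} (hc : c ≠ 0) (f : Ω → ℝ) :
    MeasurableSpace.comap (fun ω => c * f ω) inferInstance =
      MeasurableSpace.comap f inferInstance := by
  refine le_antisymm ?_ ?_
  · exact ((comap_measurable f).const_mul c).comap_le
  · have h := ((comap_measurable fun ω => c * f ω).const_mul c⁻¹).comap_le
    simpa [inv_mul_cancel_left₀ hc] using h

/-- The filtration `F (a * t)`. -/
def scaleFiltration {Ω : Type*} [m : MeasurableSpace Ω] (a : ℝ≥0) (F : Filtration ℝ≥0 m) :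
    Filtration ℝ≥0 m where
  seq t := F (a * t)
  mono' _ _ h := F.mono (mul_le_mul_right h a)
  le' _ := F.le _

theorem pastOf_scalePath {Ω : Type*} {B : Ω → CadlagPath} {r : ℝ} (hr : r ≠ 0) {a : ℝ≥0} (ha : 0 < a)
    (s : ℝ≥0) : pastOf (fun ω => scalePath r a (B ω)) s = pastOf B (a * s) := by
  simp only [pastOf, scalePath_apply, comap_const_mul hr]
  refine le_antisymm (iSup_le fun t => ?_) (iSup_le fun t => ?_)
  · exact le_iSup (fun u : Set.Iic (a * s) =>
      MeasurableSpace.comap (fun ω => B ω u) inferInstance) ⟨a * t, mul_le_mul_right t.2 a⟩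
  · have h := le_iSup (fun u : Set.Iic s =>
      MeasurableSpace.comap (fun ω => B ω (a * u)) inferInstance) ⟨t / a, by
        rw [Set.mem_Iic, div_le_iff₀ ha, mul_comm s a]; exact t.2⟩
    simpa only [mul_div_cancel₀ _ ha.ne'] using h

section

variable {Ω Ω₀ : Type*} [MeasurableSpace Ω] [MeasurableSpace Ω₀] {P : Measure Ω} {P₀ : Measure Ω₀}

theorem measurable_scale (r : ℝ) (a : ℝ≥0) :
    Measurable fun (w : ℝ≥0 → ℝ) (t : ℝ≥0) => r * w (a * t) :=
  measurable_pi_lambda _ fun t => (measurable_const_mul r).comp (measurable_pi_apply (a * t))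

/-- By self-similarity a ^ (-β) B(a t) is again a copy of the noise, and `hε` makes its coefficient
1. Nonzero factors do not change the generated σ-algebras, so the independence requirements pass to
the filtration F (a t). -/
theorem IsWeakSolution.scale {B₀ : Ω₀ → CadlagPath} {cp cm α β ε l : ℝ}
    {F : Filtration ℝ≥0 ‹MeasurableSpace Ω›} {X B : Ω → CadlagPath}
    (h : IsWeakSolution P₀ B₀ cp cm α ε P F X B) (hself : IsSelfSimilar β P₀ B₀) (hl : 0 < l)
    {a : ℝ≥0} (ha : (a : ℝ) = l ^ (1 - α)) (hε : l⁻¹ * ε = ((a : ℝ) ^ β)⁻¹) :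
    IsWeakSolution P₀ B₀ cp cm α 1 P (scaleFiltration a F) (fun ω => scalePath l⁻¹ a (X ω))
      (fun ω => scalePath ((a : ℝ) ^ β)⁻¹ a (B ω)) := by
  have ha0 : (0 : ℝ) < a := by rw [ha]; positivity
  have ha0' : 0 < a := by exact_mod_cast ha0
  have hr : ((a : ℝ) ^ β)⁻¹ ≠ 0 := by positivity
  refine ⟨fun t => ?_, fun t => ?_, ?_, fun hlevy s t hst => ?_, fun hfrac s A hA => ?_, ?_⟩
  · exact (h.adapted_solution (a * t)).const_mul _
  · exact (h.adapted_noise (a * t)).const_mul _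
  · refine (h.noise_law.comp (measurable_scale ((a : ℝ) ^ β)⁻¹ a)).trans ?_
    have h1 := (hself a ha0').comp (measurable_scale ((a : ℝ) ^ β)⁻¹ 1)
    convert h1 using 1
    · ext ω t
      simp
    · ext ω t
      simp only [Function.comp_apply, one_mul]
      rw [inv_mul_cancel_left₀ (by positivity)]
  · have h1 := h.levy hlevy (a * s) (a * t) (mul_le_mul_right hst a)
    simp only [scalePath_apply, ← mul_sub, comap_const_mul hr]
    exact h1
  · rw [pastOf_scalePath hr ha0' s]
    refine h.fractional hfrac (a * s) A ?_
    refine (iSup_le fun t => ?_ : _ ≤ ⨆ r : ℝ≥0,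
      MeasurableSpace.comap (fun ω => B ω r) inferInstance) A hA
    simp only [scalePath_apply, comap_const_mul hr]
    exact le_iSup (fun u : ℝ≥0 => MeasurableSpace.comap (fun ω => B ω u) inferInstance) (a * t)
  · filter_upwards [h.equation] with ω hω
    have h1 := hω.scale hl ha
    convert h1 using 2 with t
    rw [scalePath_apply, ← hε]
    ring

theorem IsWeakSolution.measurable_solution {B₀ : Ω₀ → CadlagPath} {cp cm α ε : ℝ}
    {F : Filtration ℝ≥0 ‹MeasurableSpace Ω›} {X B : Ω → CadlagPath}
    (h : IsWeakSolution P₀ B₀ cp cm α ε P F X B) (t : ℝ≥0) : Measurable fun ω => X ω t :=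
  (h.adapted_solution t).mono (F.le t) le_rfl

end

/-- The law of a weak solution with small noise is that of a rescaled solution with `ε = 1`. -/
theorem IsWeakSolution.map_eq_scale {Ω₀ : Type v} [MeasurableSpace Ω₀] {P₀ : Measure Ω₀}
    {B₀ : Ω₀ → CadlagPath} {cp cm α β ε l : ℝ}
    {Ω Ω' : Type u} [MeasurableSpace Ω] [MeasurableSpace Ω'] {P : Measure Ω} {P' : Measure Ω'}
    [IsProbabilityMeasure P] [IsProbabilityMeasure P']
    {F : Filtration ℝ≥0 ‹MeasurableSpace Ω›} {F' : Filtration ℝ≥0 ‹MeasurableSpace Ω'›}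
    {X B : Ω → CadlagPath} {X' B' : Ω' → CadlagPath}
    (h : IsWeakSolution P₀ B₀ cp cm α 1 P F X B) (huniq : WeakUniqueness.{u, v} P₀ B₀ cp cm α 1)
    (h' : IsWeakSolution P₀ B₀ cp cm α ε P' F' X' B') (hself : IsSelfSimilar β P₀ B₀)
    (hl : 0 < l) (hε : ε = l ^ (1 - β * (1 - α))) :
    P'.map X' = P.map fun ω => scalePath l (l ^ (-(1 - α))).toNNReal (X ω) := by
  set a : ℝ≥0 := (l ^ (1 - α)).toNNReal with ha
  have haR : (a : ℝ) = l ^ (1 - α) := Real.coe_toNNReal _ (by positivity)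
  have ha0 : 0 < a := by rw [ha, Real.toNNReal_pos]; positivity
  have hinv : (l ^ (-(1 - α))).toNNReal = a⁻¹ := by
    rw [Real.rpow_neg hl.le, Real.toNNReal_inv]
  rw [hinv]
  have hs := h'.scale hself hl haR (by
    rw [hε, haR, ← Real.rpow_mul hl.le, ← Real.rpow_neg hl.le, ← Real.rpow_neg_one,
      ← Real.rpow_add hl]
    congr 1
    ring)
  -- Uniqueness identifies the law of the rescaled X' with that of X; undoing the scaling on both
  -- sides gives the claim.
  have hid := (huniq _ _ _ _ _ _ _ _ _ _ hs h).comp (measurable_scale l a⁻¹)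
  refine map_eq_of_identDistrib h'.measurable_solution
    (fun t => (h.measurable_solution _).const_mul l) ?_
  have h1 : (fun ω (t : ℝ≥0) => X' ω t) = (fun (w : ℝ≥0 → ℝ) (t : ℝ≥0) => l * w (a⁻¹ * t)) ∘
      fun ω (t : ℝ≥0) => scalePath l⁻¹ a (X' ω) t := by
    ext ω t
    simp only [Function.comp_apply, scalePath_apply]
    rw [mul_inv_cancel_left₀ ha0.ne', mul_inv_cancel_left₀ hl.ne']
  rw [h1]
  exact hid

end SmallNoise

namespace SmallNoise

/-! ### Growth of the noise -/

theorem isSmall_of_isLittleO {γ : ℝ} {b : ℝ≥0 → ℝ}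
    (h : b =o[atTop] fun t : ℝ≥0 => (t : ℝ) ^ γ) : IsSmall γ fun t => b t.toNNReal := by
  intro δ hδ
  filter_upwards [tendsto_real_toNNReal_atTop.eventually (h.bound hδ), eventually_ge_atTop 0]
    with t ht h0
  rwa [Real.coe_toNNReal t h0, Real.norm_eq_abs, Real.norm_eq_abs,
    abs_of_nonneg (Real.rpow_nonneg h0 γ)] at ht

/-- The time S is read off from h alone and hence serves all τ n at once. -/
theorem hasSmallIncrements_of_isLittleO {γ : ℝ} {b h : ℝ≥0 → ℝ}
    (hh : h =o[atTop] fun t : ℝ≥0 => (t : ℝ) ^ γ) {τ : ℕ → ℝ≥0} (hτ : Tendsto τ atTop atTop)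
    (hb : ∀ n t, τ n ≤ t → |b t - b (τ n)| ≤ h (t - τ n)) :
    HasSmallIncrements γ fun t => b t.toNNReal := by
  intro δ hδ
  obtain ⟨S, hS⟩ := eventually_atTop.1 (hh.bound hδ)
  refine ⟨max S 1, lt_max_of_lt_right one_pos, fun M => ?_⟩
  obtain ⟨n, hn⟩ := (hτ.eventually (eventually_ge_atTop M.toNNReal)).exists
  refine ⟨τ n, (τ n).coe_nonneg, Real.toNNReal_le_iff_le_coe.1 hn, fun t ht => ?_⟩
  have ht0 : 0 ≤ t := zero_le_one.trans ((le_max_right _ _).trans ht)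
  have h1 := hb n (τ n + t.toNNReal) le_self_add
  have h2 := hS t.toNNReal (NNReal.le_toNNReal_of_coe_le ((le_max_left _ _).trans ht))
  rw [add_tsub_cancel_left] at h1
  rw [Real.coe_toNNReal t ht0, Real.norm_eq_abs, Real.norm_eq_abs,
    abs_of_nonneg (Real.rpow_nonneg ht0 γ)] at h2
  change |b ((τ n : ℝ) + t).toNNReal - b (τ n : ℝ).toNNReal| ≤ _
  rw [Real.toNNReal_add (τ n).coe_nonneg ht0, Real.toNNReal_coe]
  exact h1.trans ((le_abs_self _).trans h2)

theorem tendsto_comp_toNNReal {x : ℝ≥0 → ℝ} {l : Filter ℝ} :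
    Tendsto (fun t : ℝ => x t.toNNReal) atTop l ↔ Tendsto x atTop l := by
  refine ⟨fun h => ?_, fun h => h.comp tendsto_real_toNNReal_atTop⟩
  have h1 : Tendsto (fun t : ℝ≥0 => (t : ℝ)) atTop atTop := NNReal.tendsto_coe_atTop.2 tendsto_id
  simpa [Function.comp_def] using h.comp h1

/-! ### The limit process -/

section

variable {Ω : Type*} {X : Ω → CadlagPath} {cp cm α : ℝ}

theorem disjoint_toPosInfty_toNegInfty (X : Ω → CadlagPath) :
    Disjoint (toPosInfty X) (toNegInfty X) := by
  rw [Set.disjoint_left]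
  intro ω h1 h2
  have h1' : Tendsto (X ω) atTop atTop := h1
  exact h1'.not_tendsto disjoint_atTop_atBot h2

theorem limitProcess_of_mem_toPosInfty (hα : α < 1) {ω : Ω} (h : ω ∈ toPosInfty X) :
    limitProcess cp cm α hα X ω = maxPath cp α hα := by
  have h' : ω ∉ toNegInfty X := Set.disjoint_left.1 (disjoint_toPosInfty_toNegInfty X) h
  simp [limitProcess, maxPath, h, h']

theorem limitProcess_of_mem_toNegInfty (hα : α < 1) {ω : Ω} (h : ω ∈ toNegInfty X) :
    limitProcess cp cm α hα X ω = minPath cm α hα := by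
  have h' : ω ∉ toPosInfty X := Set.disjoint_right.1 (disjoint_toPosInfty_toNegInfty X) h
  simp [limitProcess, minPath, h, h']

theorem limitProcess_of_notMem (hα : α < 1) {ω : Ω} (h : ω ∉ toPosInfty X)
    (h' : ω ∉ toNegInfty X) : limitProcess cp cm α hα X ω = powerPath α hα 0 := by
  simp [limitProcess, h, h']

theorem powerPath_injective (hα : α < 1) : Function.Injective (powerPath α hα) := by
  intro k k' h
  have h1 : powerPath α hα k 1 = powerPath α hα k' 1 := by rw [h]
  have h2 : (0 : ℝ) < (1 - α) ^ (1 / (1 - α)) := Real.rpow_pos_of_pos (by linarith) _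
  rw [powerPath_apply, powerPath_apply, NNReal.coe_one, Real.one_rpow, mul_one, mul_one] at h1
  exact mul_left_cancel₀ h2.ne' h1

/-- The three possible values of the limit have the distinct constants c₊ ^ γ, -c₋ ^ γ and 0, so
each value determines its event. -/
theorem setOf_limitProcess_eq_maxPath (hcp : 0 < cp) (hcm : 0 < cm) (hα : α < 1) :
    {ω | limitProcess cp cm α hα X ω = maxPath cp α hα} = toPosInfty X := by
  have hp : 0 < cp ^ (1 / (1 - α)) := Real.rpow_pos_of_pos hcp _
  have hm : 0 < cm ^ (1 / (1 - α)) := Real.rpow_pos_of_pos hcm _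
  refine Set.Subset.antisymm (fun ω h => ?_) fun ω h => limitProcess_of_mem_toPosInfty hα h
  by_contra hpos
  rw [Set.mem_ofPred_eq] at h
  by_cases hneg : ω ∈ toNegInfty X
  · rw [limitProcess_of_mem_toNegInfty hα hneg] at h
    linarith [powerPath_injective hα h]
  · rw [limitProcess_of_notMem hα hpos hneg] at h
    linarith [powerPath_injective hα h]

theorem setOf_limitProcess_eq_minPath (hcp : 0 < cp) (hcm : 0 < cm) (hα : α < 1) :
    {ω | limitProcess cp cm α hα X ω = minPath cm α hα} = toNegInfty X := by
  have hp : 0 < cp ^ (1 / (1 - α)) := Real.rpow_pos_of_pos hcp _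
  have hm : 0 < cm ^ (1 / (1 - α)) := Real.rpow_pos_of_pos hcm _
  refine Set.Subset.antisymm (fun ω h => ?_) fun ω h => limitProcess_of_mem_toNegInfty hα h
  by_contra hneg
  rw [Set.mem_ofPred_eq] at h
  by_cases hpos : ω ∈ toPosInfty X
  · rw [limitProcess_of_mem_toPosInfty hα hpos] at h
    linarith [powerPath_injective hα h]
  · rw [limitProcess_of_notMem hα hpos hneg] at h
    linarith [powerPath_injective hα h]

/-- Rescaled solutions of the equation converge to the limit process. -/
theorem SolvesEquation.tendsto_scalePath_of_growth (hcp : 0 < cp) (hcm : 0 < cm) (hα : α < 1)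
    {ω : Ω} {g : ℝ≥0 → ℝ} (h : SolvesEquation cp cm α (X ω) g)
    (hg : (0 < α ∧ HasSmallIncrements (1 / (1 - α)) fun t => g t.toNNReal) ∨
      (α ≤ 0 ∧ IsSmall (1 / (1 - α)) fun t => g t.toNNReal))
    (hX : Tendsto (fun t : ℝ≥0 => |X ω t|) atTop atTop) :
    Tendsto (fun l : ℝ => scalePath l (l ^ (-(1 - α))).toNNReal (X ω)) (𝓝[>] 0)
      (𝓝 (limitProcess cp cm α hα X ω)) ∧
    (0 < α → ω ∈ toPosInfty X ∪ toNegInfty X) := by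
  have h1 : 0 ≤ 1 - α := by linarith
  rcases h.hasPowerDrift.asymptotics h.hasPowerDrift_neg hcp hcm hα hg
    (tendsto_comp_toNNReal (x := fun t => |X ω t|).2 hX) with
    ⟨h2, h3⟩ | ⟨h2, h3⟩ | ⟨hα0, h2, h2', h3⟩ <;> rw [tendsto_comp_toNNReal] at h2
  · refine ⟨?_, fun _ => Or.inl h2⟩
    rw [limitProcess_of_mem_toPosInfty hα h2]
    refine tendsto_scalePath hα ?_
    rwa [← Real.mul_rpow h1 hcp.le, mul_comm (1 - α)]
  · refine ⟨?_, fun _ => Or.inr h2⟩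
    rw [limitProcess_of_mem_toNegInfty hα h2]
    refine tendsto_scalePath hα ?_
    rwa [mul_neg, ← Real.mul_rpow h1 hcm.le, mul_comm (1 - α)]
  · rw [tendsto_comp_toNNReal] at h2'
    refine ⟨?_, fun h => absurd h (not_lt.2 hα0)⟩
    rw [limitProcess_of_notMem hα h2 h2']
    refine tendsto_scalePath hα ?_
    rwa [mul_zero]

end

/-! ### Almost sure convergence and measurability of the limit -/

section

variable {Ω Ω₀ : Type*} [MeasurableSpace Ω] [MeasurableSpace Ω₀] {P : Measure Ω} {P₀ : Measure Ω₀}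
  {B₀ : Ω₀ → CadlagPath} {cp cm α : ℝ} {F : Filtration ℝ≥0 ‹MeasurableSpace Ω›}
  {X B : Ω → CadlagPath}

theorem IsWeakSolution.ae_tendsto_scalePath (h : IsWeakSolution P₀ B₀ cp cm α 1 P F X B)
    (hcp : 0 < cp) (hcm : 0 < cm) (hα : α < 1)
    (hX : ∀ᵐ ω ∂P, Tendsto (fun t : ℝ≥0 => |X ω t|) atTop atTop)
    (hgrowth : (0 < α ∧ IncrementGrowth α P B) ∨ (α ≤ 0 ∧ SublinearGrowth α P B)) :
    ∀ᵐ ω ∂P, Tendsto (fun l : ℝ => scalePath l (l ^ (-(1 - α))).toNNReal (X ω)) (𝓝[>] 0)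
        (𝓝 (limitProcess cp cm α hα X ω)) ∧
      (0 < α → ω ∈ toPosInfty X ∪ toNegInfty X) := by
  have hg : ∀ᵐ ω ∂P, (0 < α ∧ HasSmallIncrements (1 / (1 - α)) fun t => B ω t.toNNReal) ∨
      (α ≤ 0 ∧ IsSmall (1 / (1 - α)) fun t => B ω t.toNNReal) := by
    rcases hgrowth with ⟨hα0, g, hg, hB⟩ | ⟨hα0, hB⟩
    · filter_upwards [hB] with ω ⟨τ, hτ, hω⟩
      exact Or.inl ⟨hα0, hasSmallIncrements_of_isLittleO hg hτ hω⟩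
    · filter_upwards [hB] with ω hω
      exact Or.inr ⟨hα0, isSmall_of_isLittleO hω⟩
  filter_upwards [h.equation, hX, hg] with ω h1 h2 h3
  refine h1.tendsto_scalePath_of_growth hcp hcm hα ?_ h2
  simpa only [one_mul] using h3

theorem IsWeakSolution.aemeasurable_limit (h : IsWeakSolution P₀ B₀ cp cm α 1 P F X B)
    (hα : α < 1)
    (hlim : ∀ᵐ ω ∂P, Tendsto (fun l : ℝ => scalePath l (l ^ (-(1 - α))).toNNReal (X ω)) (𝓝[>] 0)
      (𝓝 (limitProcess cp cm α hα X ω))) :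
    AEMeasurable (limitProcess cp cm α hα X) P :=
  aemeasurable_of_tendsto_metrizable_ae (𝓝[>] (0 : ℝ))
    (fun l => (measurable_of_measurable_eval fun _ =>
      (h.measurable_solution _).const_mul l).aemeasurable) hlim

/-- Divergence in continuous time involves uncountably many times. Once X tends to +∞ or -∞ a.s.,
divergence along the integers decides which. -/
theorem IsWeakSolution.nullMeasurableSet_toPosInfty
    (h : IsWeakSolution P₀ B₀ cp cm α 1 P F X B)
    (hX : ∀ᵐ ω ∂P, ω ∈ toPosInfty X ∪ toNegInfty X) : NullMeasurableSet (toPosInfty X) P := by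
  have hm : MeasurableSet {ω | Tendsto (fun n : ℕ => X ω n) atTop atTop} :=
    measurableSet_tendsto atTop fun n => h.measurable_solution n
  refine hm.nullMeasurableSet.congr ?_
  filter_upwards [hX] with ω hω
  refine propext ⟨fun h1 => hω.resolve_right fun h2 => ?_, fun h1 => ?_⟩
  · have h2' : Tendsto (X ω) atTop atBot := h2
    have h1' : Tendsto (fun n : ℕ => X ω n) atTop atTop := h1
    exact h1'.not_tendsto disjoint_atTop_atBot (h2'.comp tendsto_natCast_atTop_atTop)
  · have h1' : Tendsto (X ω) atTop atTop := h1
    exact h1'.comp tendsto_natCast_atTop_atTop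

end

end SmallNoise

/-! ### Convergence in distribution and the main theorem -/

theorem mainTheorem1 {Ω₀ : Type v} [MeasurableSpace Ω₀] (P₀ : Measure Ω₀)
    [IsProbabilityMeasure P₀] (B₀ : Ω₀ → SmallNoise.CadlagPath)
    (cp cm α β : ℝ) (hcp : 0 < cp) (hcm : 0 < cm) (hα : -1 < α) (hα1 : α < 1) (hβ : 0 < β)
    (hαβ : 1 < α + β⁻¹)
    (hself : SmallNoise.IsSelfSimilar β P₀ B₀)
    -- a weak solution of the equation with `ε = 1`, and its uniqueness in law
    {Ω : Type u} [MeasurableSpace Ω] (P : Measure Ω) [IsProbabilityMeasure P]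
    (F : Filtration ℝ≥0 ‹MeasurableSpace Ω›) (X B : Ω → SmallNoise.CadlagPath)
    (hX : SmallNoise.IsWeakSolution P₀ B₀ cp cm α 1 P F X B)
    (huniq : SmallNoise.WeakUniqueness.{u, v} P₀ B₀ cp cm α 1)
    (hinfty : ∀ᵐ ω ∂P, Tendsto (fun t : ℝ≥0 => |X ω t|) atTop atTop)
    (hgrowth : (0 < α ∧ SmallNoise.IncrementGrowth α P B) ∨
      (α ≤ 0 ∧ SmallNoise.SublinearGrowth α P B))
    -- for every `ε > 0`, a weak solution of the equation with noise `ε B`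
    {Ωε : Set.Ioi (0 : ℝ) → Type u} [∀ ε, MeasurableSpace (Ωε ε)]
    (Pε : ∀ ε, Measure (Ωε ε)) [∀ ε, IsProbabilityMeasure (Pε ε)]
    (Fε : ∀ ε, Filtration ℝ≥0 (inferInstance : MeasurableSpace (Ωε ε)))
    (Xε Bε : ∀ ε, Ωε ε → SmallNoise.CadlagPath)
    (hXε : ∀ ε : Set.Ioi (0 : ℝ), SmallNoise.IsWeakSolution P₀ B₀ cp cm α (ε : ℝ) (Pε ε) (Fε ε) (Xε ε) (Bε ε)) :
    -- convergence in distribution in `D([0,∞))` as `ε → 0+`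
    TendstoInDistribution Xε (comap ((↑) : Set.Ioi (0 : ℝ) → ℝ) (𝓝 0))
      (SmallNoise.limitProcess cp cm α hα1 X) Pε P ∧
    -- `X⁺` and `X⁻` are the maximal and the minimal solution of the limit equation
    (SmallNoise.SolvesEquation cp cm α (SmallNoise.maxPath cp α hα1) 0 ∧
      SmallNoise.SolvesEquation cp cm α (SmallNoise.minPath cm α hα1) 0 ∧
      ∀ y : SmallNoise.CadlagPath, SmallNoise.SolvesEquation cp cm α y 0 →
        ∀ t, SmallNoise.minPath cm α hα1 t ≤ y t ∧ y t ≤ SmallNoise.maxPath cp α hα1 t) ∧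
    -- the limit takes these two values with probabilities `p₊` and `p₋`
    P {ω | SmallNoise.limitProcess cp cm α hα1 X ω = SmallNoise.maxPath cp α hα1} =
      P (SmallNoise.toPosInfty X) ∧
    P {ω | SmallNoise.limitProcess cp cm α hα1 X ω = SmallNoise.minPath cm α hα1} =
      P (SmallNoise.toNegInfty X) ∧
    (0 < α → P (SmallNoise.toPosInfty X) + P (SmallNoise.toNegInfty X) = 1) := by
  have hae := hX.ae_tendsto_scalePath hcp hcm hα1 hinfty hgrowth
  have hlim : ∀ᵐ ω ∂P, Tendsto (fun l : ℝ => SmallNoise.scalePath l (l ^ (-(1 - α))).toNNReal (X ω))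
      (𝓝[>] 0) (𝓝 (SmallNoise.limitProcess cp cm α hα1 X ω)) := hae.mono fun ω h => h.1
  have hlimm := hX.aemeasurable_limit hα1 hlim
  -- This is α + β⁻¹ > 1 multiplied by β; it ensures that l = ε ^ (1 / (1 - β (1 - α))) tends to 0
  -- with ε.
  have hκ : 0 < 1 - β * (1 - α) := by
    have h1 : β * (1 - α) < β * β⁻¹ := by gcongr; linarith
    rw [mul_inv_cancel₀ hβ.ne'] at h1
    linarith
  refine ⟨⟨fun ε => (SmallNoise.measurable_of_measurable_eval
    (hXε ε).measurable_solution).aemeasurable, hlimm, ?_⟩,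
    SmallNoise.extremal_solutions hcp hcm hα1, ?_, ?_, fun hα0 => ?_⟩
  · refine ProbabilityMeasure.tendsto_iff_forall_integral_tendsto.2 fun f => ?_
    have hl : Tendsto (fun ε : Set.Ioi (0 : ℝ) => (ε : ℝ) ^ (1 / (1 - β * (1 - α))))
        (comap ((↑) : Set.Ioi (0 : ℝ) → ℝ) (𝓝 0)) (𝓝[>] 0) := by
      refine tendsto_nhdsWithin_iff.2 ⟨?_, Eventually.of_forall fun ε =>
        Real.rpow_pos_of_pos ε.2 _⟩
      have h1 := (Real.continuous_rpow_const (one_div_pos.2 hκ).le).tendsto 0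
      rw [Real.zero_rpow (one_div_pos.2 hκ).ne'] at h1
      exact h1.comp tendsto_comap
    -- All expectations are moved to the one space carrying X, where a.s. convergence and the bound
    -- ‖f‖ allow dominated convergence.
    have hint : ∀ ε : Set.Ioi (0 : ℝ), ∫ x, f x ∂(Pε ε).map (Xε ε) =
        ∫ ω, f (SmallNoise.scalePath ((ε : ℝ) ^ (1 / (1 - β * (1 - α))))
          (((ε : ℝ) ^ (1 / (1 - β * (1 - α)))) ^ (-(1 - α))).toNNReal (X ω)) ∂P := by
      intro ε
      have hε0 : (0 : ℝ) < ε := ε.2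
      rw [hX.map_eq_scale huniq (hXε ε) hself (Real.rpow_pos_of_pos hε0 _) (by
        rw [← Real.rpow_mul hε0.le, one_div_mul_cancel hκ.ne', Real.rpow_one]),
        integral_map _ f.continuous.measurable.aestronglyMeasurable]
      exact (SmallNoise.measurable_of_measurable_eval fun t =>
        (hX.measurable_solution _).const_mul _).aemeasurable
    change Tendsto (fun ε => ∫ x, f x ∂(Pε ε).map (Xε ε)) _
      (𝓝 (∫ x, f x ∂P.map (SmallNoise.limitProcess cp cm α hα1 X)))
    rw [integral_map hlimm f.continuous.measurable.aestronglyMeasurable]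
    simp only [hint]
    refine tendsto_integral_filter_of_dominated_convergence (fun _ => ‖f‖)
      (Eventually.of_forall fun ε => ?_)
      (Eventually.of_forall fun ε => ae_of_all _ fun ω => f.norm_coe_le_norm _)
      (integrable_const _) ?_
    · exact (f.continuous.measurable.comp (SmallNoise.measurable_of_measurable_eval fun t =>
        (hX.measurable_solution _).const_mul _)).aestronglyMeasurable
    · filter_upwards [hlim] with ω hω
      exact (f.continuous.tendsto _).comp (hω.comp hl)
  · rw [SmallNoise.setOf_limitProcess_eq_maxPath hcp hcm hα1]
  · rw [SmallNoise.setOf_limitProcess_eq_minPath hcp hcm hα1]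
  · have hmem : ∀ᵐ ω ∂P, ω ∈ SmallNoise.toPosInfty X ∪ SmallNoise.toNegInfty X :=
      hae.mono fun ω h => h.2 hα0
    rw [← measure_union₀' (hX.nullMeasurableSet_toPosInfty hmem)
      (SmallNoise.disjoint_toPosInfty_toNegInfty X).aedisjoint]
    exact (measure_eq_measure_of_null_sdiff (Set.subset_univ _) (by
      rw [← Set.compl_eq_univ_sdiff]
      exact hmem)).trans measure_univ
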